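/- All graphs are finite, simple, undirected and connected. A graph $G$ is \emph{cyclically $k$-edge-connected} if there is no set $A\subseteq E(G)$ of at most $k-1$ edges such that $G\setminus A$ has at least two connected components containing a cycle. Embeddings of $G$ on closed surfaces are cellular, and are described combinatorially by a rotation system (a cyclic ordering of the edges at each vertex) together with a signature $\lambda:E(G)\to\{1,-1\}$ (the edges with $\lambda(e)=-1$ are twisted); the facial walks are obtained by face tracing. The surface is orientable if and only if reversing the rotations at suitable vertices makes all edges untwisted, and it then has genus $g$ where $|V(G)|-|E(G)|+|F|=2-2g$, with $F$ the set of facial walks up to starting point and direction. $G$ is \emph{planar} if it has an embedding on the sphere (the orientable surface of genus $0$). An embedding is \emph{strong} if every facial walk is a cycle. \textbf{Theorem.} Let $G$ be a cubic planar graph that is not isomorphic to $K_4$. If $G$ is cyclically $4$-edge-connected, then $G$ has a strong embedding on an orientable surface of positive genus. -/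

import Mathlib

namespace SimpleGraph

variable {V : Type*}

/-- `G` is cyclically `k`-edge-connected: there is no set `A` of at most `k - 1` edges of `G` such
that `G \ A` has at least two connected components containing a cycle. -/
def IsCyclicallyEdgeConnected (G : SimpleGraph V) (k : ℕ) : Prop :=
  ∀ A : Finset (Sym2 V), (A : Set (Sym2 V)) ⊆ G.edgeSet → A.card < k →
    ¬ ∃ c₁ c₂ : (G.deleteEdges (A : Set (Sym2 V))).ConnectedComponent, c₁ ≠ c₂ ∧
      (∃ v ∈ c₁.supp, ∃ w : (G.deleteEdges (A : Set (Sym2 V))).Walk v v, w.IsCycle) ∧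
      (∃ v ∈ c₂.supp, ∃ w : (G.deleteEdges (A : Set (Sym2 V))).Walk v v, w.IsCycle)

/-- A cellular embedding of a connected graph `G` with at least one edge on a closed surface, given
by a rotation system together with a signature: `rot` maps a dart (an edge directed away from its
initial vertex) to the next dart with the same initial vertex in the local clockwise orientation,
and `sig` is `-1` exactly on the twisted edges. -/
structure CellularEmbedding (G : SimpleGraph V) where
  rot : Equiv.Perm G.Dart
  rot_isCycleOn : ∀ v : V, rot.IsCycleOn {d : G.Dart | d.fst = v}
  sig : G.edgeSet → ℤˣ

namespace CellularEmbedding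

variable {G : SimpleGraph V}

/-- The sign of the edge underlying a dart. -/
def dartSig (e : G.CellularEmbedding) (d : G.Dart) : ℤˣ := e.sig ⟨d.edge, d.edge_mem⟩

/-- One step of face tracing. A state `(d, ε)` means that the walk is about to traverse `d`, where
`ε` records whether the rotation at the initial vertex of `d` is read clockwise (`1`) or
anticlockwise (`-1`). Traversing a twisted edge changes `ε`. At the end of `d` the walk continues
with the dart next to the reversal of `d` in the current orientation. -/
def next (e : G.CellularEmbedding) (x : G.Dart × ℤˣ) : G.Dart × ℤˣ :=
  ((e.rot ^ ((x.2 * e.dartSig x.1 : ℤˣ) : ℤ)) x.1.symm, x.2 * e.dartSig x.1)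

/-- The state which traverses the same side of the same edge in the opposite direction. -/
def reverse (e : G.CellularEmbedding) (x : G.Dart × ℤˣ) : G.Dart × ℤˣ :=
  (x.1.symm, -(x.2 * e.dartSig x.1))

theorem rot_zpow_fst (e : G.CellularEmbedding) (n : ℤ) (d : G.Dart) :
    ((e.rot ^ n) d).fst = d.fst :=
  ((e.rot_isCycleOn d.fst).1.perm_zpow n).mapsTo (rfl : d.fst = d.fst)

theorem adj_next (e : G.CellularEmbedding) (x : G.Dart × ℤˣ) :
    G.Adj x.1.fst (e.next x).1.fst := by
  have h : (e.next x).1.fst = x.1.snd := e.rot_zpow_fst _ _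
  rw [h]
  exact x.1.adj

/-- The walk that traverses the first `n` darts of the face tracing starting in the state `x`. -/
def traceWalk (e : G.CellularEmbedding) :
    (n : ℕ) → (x : G.Dart × ℤˣ) → G.Walk x.1.fst (e.next^[n] x).1.fst
  | 0, _ => Walk.nil
  | n + 1, x => Walk.cons (e.adj_next x) (e.traceWalk n (e.next x))

/-- The facial walk through the state `x`: trace the face until the state `x` recurs for the first
time. -/
noncomputable def facialWalk (e : G.CellularEmbedding) (x : G.Dart × ℤˣ) :
    G.Walk x.1.fst x.1.fst :=
  (e.traceWalk (Function.minimalPeriod e.next x) x).copy rfl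
    (by rw [Function.iterate_minimalPeriod])

/-- An embedding is strong if all its facial walks are cycles. -/
def IsStrong (e : G.CellularEmbedding) : Prop :=
  ∀ x : G.Dart × ℤˣ, (e.facialWalk x).IsCycle

/-- The cells of the embedding: facial walks up to the choice of the starting point and of the
direction of traversal. -/
def Cell (e : G.CellularEmbedding) : Type _ :=
  Quot fun x y : G.Dart × ℤˣ => y = e.next x ∨ y = e.reverse x

/-- The Euler characteristic `|V| - |E| + |F|` of the surface. -/
noncomputable def eulerChar (e : G.CellularEmbedding) : ℤ :=
  (Nat.card V : ℤ) - Nat.card G.edgeSet + Nat.card e.Cell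

/-- The surface is orientable: the local orientations at the vertices can be chosen (by reversing
the rotations at the vertices with `o v = -1`) so that they agree along every edge, that is, so
that no edge is twisted any more. -/
def IsOrientable (e : G.CellularEmbedding) : Prop :=
  ∃ o : V → ℤˣ, ∀ d : G.Dart, e.dartSig d = o d.fst * o d.snd

/-- The surface is the closed orientable surface of genus `g`. -/
def IsOrientableOfGenus (e : G.CellularEmbedding) (g : ℕ) : Prop :=
  e.IsOrientable ∧ e.eulerChar = 2 - 2 * (g : ℤ)

end CellularEmbedding

/-- A connected graph (with at least one edge) is planar if it has an embedding on the sphere. -/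
def IsPlanar (G : SimpleGraph V) : Prop :=
  ∃ e : G.CellularEmbedding, e.IsOrientableOfGenus 0

end SimpleGraph

/-! Let `ρ` be a spherical rotation of the graph. On the sphere, a mod-2 cochain that sums to zero
around every face is a coboundary, so the edges crossed by a dual cycle form an edge cut. In a
cyclically 4-edge-connected cubic graph, a nonempty cut of at most three edges is the star of a
vertex. Hence dual cycles of length at most three come only from vertices (`isTightRotation`): the
dual is a simple graph whose triangles are vertex stars.

The new embedding reverses `ρ` on one side `S` of a nonempty cut whose edges each join a face in `A`
to a face in `B`, with `A` and `B` independent in the dual. A new facial walk follows one old face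
until a cut edge moves it to the other face of that edge. So it sees `A` inside `S` and `B` outside,
or the reverse, or else it stays in one old face throughout. Different corners at a vertex lie in
adjacent old faces, so no walk repeats a vertex (`IsTightRotation.eq_of_flip`). The result is not
spherical, because it carries a closed cochain that is not a coboundary
(`IsTightRotation.card_face_flip_ne`). The parity of the number of faces is unchanged
(`card_face_mod_two`), so the genus is an integer.

A suitable cut always exists. A face of even length has an even cycle of neighbours, coloured
alternately. An induced dual 4-cycle is cut by its four edges, with opposite faces as colour
classes. If neither exists, all faces are odd; length 3 would force `K₄`, so all lengths are at
least 5. The faces surrounding two adjacent faces then form an even closed sequence, and the absence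
of induced dual 4-cycles makes its alternating classes independent. -/

namespace SimpleGraph

open Equiv

variable {V : Type*} {G : SimpleGraph V}

/-! ### Rotations, faces and mod-2 cohomology of the surface. -/

/-- The reversal of darts as a permutation. -/
def dartReversal (G : SimpleGraph V) : Perm G.Dart := Dart.symm_involutive.toPerm _

/-- A permutation of the darts is a rotation if it permutes the darts at each vertex cyclically. -/
def IsRotation (ρ : Perm G.Dart) : Prop := ∀ v : V, ρ.IsCycleOn {d : G.Dart | d.fst = v}

/-- The permutation tracing the faces on the left of the darts. -/
def facePerm (ρ : Perm G.Dart) : Perm G.Dart := ρ * G.dartReversal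

@[simp] theorem facePerm_apply (ρ : Perm G.Dart) (d : G.Dart) : facePerm ρ d = ρ d.symm := rfl

/-- The faces of a rotation. -/
def Face (ρ : Perm G.Dart) : Type _ := Quotient (Perm.SameCycle.setoid (facePerm ρ))

/-- The face on the left of a dart. -/
def leftFace (ρ : Perm G.Dart) (d : G.Dart) : Face ρ :=
  Quotient.mk (Perm.SameCycle.setoid (facePerm ρ)) d

theorem leftFace_eq_iff {ρ : Perm G.Dart} {d d' : G.Dart} :
    leftFace ρ d = leftFace ρ d' ↔ (facePerm ρ).SameCycle d d' :=
  Quotient.eq (r := Perm.SameCycle.setoid (facePerm ρ))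

theorem leftFace_surjective (ρ : Perm G.Dart) : Function.Surjective (leftFace ρ) :=
  Quotient.exists_rep

@[simp] theorem leftFace_facePerm (ρ : Perm G.Dart) (d : G.Dart) :
    leftFace ρ (facePerm ρ d) = leftFace ρ d :=
  leftFace_eq_iff.2 (Perm.sameCycle_apply_left.2 (Perm.SameCycle.refl _ _))

theorem leftFace_rot (ρ : Perm G.Dart) (d : G.Dart) : leftFace ρ (ρ d) = leftFace ρ d.symm := by
  rw [← leftFace_facePerm ρ d.symm, facePerm_apply, Dart.symm_symm]

@[simp] theorem leftFace_facePerm_pow (ρ : Perm G.Dart) (n : ℕ) (d : G.Dart) :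
    leftFace ρ ((facePerm ρ ^ n) d) = leftFace ρ d :=
  leftFace_eq_iff.2 (Perm.sameCycle_pow_left.2 (Perm.SameCycle.refl _ _))

theorem IsRotation.fst_apply {ρ : Perm G.Dart} (hρ : IsRotation ρ) (d : G.Dart) :
    (ρ d).fst = d.fst :=
  (hρ d.fst).1.mapsTo (rfl : d.fst = d.fst)

theorem IsRotation.fst_facePerm {ρ : Perm G.Dart} (hρ : IsRotation ρ) (d : G.Dart) :
    (facePerm ρ d).fst = d.snd :=
  hρ.fst_apply d.symm

instance [Finite V] : Finite G.Dart := Finite.of_injective _ Dart.toProd_injective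

instance [Finite V] (ρ : Perm G.Dart) : Finite (Face ρ) :=
  Finite.of_surjective _ (leftFace_surjective ρ)

/-- In a connected graph, the rotation and the reversal act transitively on the darts. -/
theorem IsRotation.dart_induction [Finite V] (hG : G.Connected) {ρ : Perm G.Dart}
    (hρ : IsRotation ρ) {P : G.Dart → Prop} (hrot : ∀ d, P d → P (ρ d))
    (hsymm : ∀ d, P d → P d.symm) {d₀ : G.Dart} (h₀ : P d₀) (d : G.Dart) : P d := by
  have key : ∀ d d' : G.Dart, d.fst = d'.fst → P d → P d' := by
    intro d d' h hd
    obtain ⟨n, rfl⟩ := (hρ d.fst).exists_pow_eq' (Set.toFinite _) (rfl : d.fst = d.fst) h.symm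
    clear h
    induction n with
    | zero => exact hd
    | succ n ih => rw [pow_succ', Perm.mul_apply]; exact hrot _ ih
  have walk : ∀ u w : V, G.Walk u w → (∀ d : G.Dart, d.fst = u → P d) →
      ∀ d : G.Dart, d.fst = w → P d := by
    intro u w p
    induction p with
    | nil => exact id
    | cons h p ih =>
      intro hu
      apply ih
      intro d hd
      exact key _ _ (by exact hd.symm) (hsymm ⟨(_, _), h⟩ (hu _ rfl))
  obtain ⟨p⟩ := hG.preconnected d₀.fst d.fst
  exact walk _ _ p (fun d hd => key _ _ hd.symm h₀) d rfl

/-- The edge underlying a dart. -/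
def dartEdge (d : G.Dart) : G.edgeSet := ⟨d.edge, d.edge_mem⟩

theorem dartEdge_eq_iff {d d' : G.Dart} : dartEdge d = dartEdge d' ↔ d = d' ∨ d = d'.symm := by
  rw [← dart_edge_eq_iff, dartEdge, dartEdge, Subtype.mk.injEq]

theorem dartEdge_surjective : Function.Surjective (dartEdge : G.Dart → G.edgeSet) := by
  rintro ⟨e, he⟩
  induction e with
  | h u v => exact ⟨⟨(u, v), he⟩, rfl⟩

/-- The coboundary of a 0-cochain modulo 2. -/
noncomputable def coboundary (G : SimpleGraph V) : (V → ZMod 2) →ₗ[ZMod 2] (G.edgeSet → ZMod 2) where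
  toFun s e := s (dartEdge_surjective e).choose.fst + s (dartEdge_surjective e).choose.snd
  map_add' s t := by ext e; simp only [Pi.add_apply]; ring
  map_smul' c s := by ext e; simp only [Pi.smul_apply, smul_eq_mul, RingHom.id_apply]; ring

theorem coboundary_dartEdge (s : V → ZMod 2) (d : G.Dart) :
    G.coboundary s (dartEdge d) = s d.fst + s d.snd := by
  have h := (dartEdge_surjective (dartEdge d)).choose_spec
  rw [dartEdge_eq_iff] at h
  change s (dartEdge_surjective (dartEdge d)).choose.fst +
    s (dartEdge_surjective (dartEdge d)).choose.snd = _
  rcases h with h | h <;> rw [h]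
  exact add_comm _ _

theorem ker_coboundary_le (hG : G.Connected) :
    LinearMap.ker G.coboundary ≤ Submodule.span (ZMod 2) {fun _ => 1} := by
  intro s hs
  rw [Submodule.mem_span_singleton]
  obtain ⟨v₀⟩ := hG.nonempty
  refine ⟨s v₀, funext fun v => ?_⟩
  have hadj : ∀ u w, G.Adj u w → s u = s w := by
    intro u w h
    have := congrFun (LinearMap.mem_ker.1 hs) (dartEdge ⟨(u, w), h⟩)
    rw [coboundary_dartEdge] at this
    exact CharTwo.add_eq_zero.1 this
  obtain ⟨p⟩ := hG.preconnected v₀ v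
  have : ∀ u w : V, G.Walk u w → s u = s w := by
    intro u w p
    induction p with
    | nil => rfl
    | cons h p ih => exact (hadj _ _ h).trans ih
  simpa using this _ _ p

section Boundary

open scoped Classical

variable [Fintype G.Dart]

/-- The sum of a 1-cochain modulo 2 along the boundary of each face. -/
noncomputable def faceSum (ρ : Perm G.Dart) :
    (G.edgeSet → ZMod 2) →ₗ[ZMod 2] (Face ρ → ZMod 2) where
  toFun x f := ∑ d with leftFace ρ d = f, x (dartEdge d)
  map_add' x y := by ext f; simp [Finset.sum_add_distrib]
  map_smul' c x := by ext f; simp [Finset.mul_sum]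

theorem faceSum_apply (ρ : Perm G.Dart) (x : G.edgeSet → ZMod 2) (f : Face ρ) :
    faceSum ρ x f = ∑ d with leftFace ρ d = f, x (dartEdge d) := rfl

/-- Sums of the form `y d + y (next dart)` along a face vanish modulo 2. -/
theorem sum_add_facePerm_eq_zero (ρ : Perm G.Dart) (f : Face ρ) (y : G.Dart → ZMod 2) :
    ∑ d with leftFace ρ d = f, (y d + y (facePerm ρ d)) = 0 := by
  rw [Finset.sum_add_distrib]
  have : ∑ d with leftFace ρ d = f, y (facePerm ρ d) = ∑ d with leftFace ρ d = f, y d := by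
    refine Finset.sum_equiv (facePerm ρ) (fun d => ?_) (fun d _ => rfl)
    simp only [Finset.mem_filter, Finset.mem_univ, true_and, leftFace_facePerm]
  rw [this]
  exact CharTwo.add_self_eq_zero _

theorem faceSum_coboundary {ρ : Perm G.Dart} (hρ : IsRotation ρ) (s : V → ZMod 2) :
    faceSum ρ (G.coboundary s) = 0 := by
  ext f
  rw [faceSum_apply, Pi.zero_apply, ← sum_add_facePerm_eq_zero ρ f (fun d => s d.fst)]
  refine Finset.sum_congr rfl fun d _ => ?_
  rw [coboundary_dartEdge, hρ.fst_facePerm]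

theorem faceSum_single (ρ : Perm G.Dart) (a : G.Dart) :
    faceSum ρ (Pi.single (dartEdge a) 1) =
      Pi.single (leftFace ρ a) 1 + Pi.single (leftFace ρ a.symm) 1 := by
  ext f
  rw [faceSum_apply]
  have h : ∀ d : G.Dart, (Pi.single (dartEdge a) (1 : ZMod 2) : G.edgeSet → ZMod 2) (dartEdge d) =
      (if d = a then 1 else 0) + (if d = a.symm then 1 else 0) := by
    intro d
    simp only [Pi.single_apply, dartEdge_eq_iff]
    have := a.symm_ne
    by_cases h1 : d = a
    · subst h1; simp [this.symm]
    · simp [h1]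
  simp only [h, Finset.sum_add_distrib, Finset.sum_ite_eq', Finset.mem_filter, Finset.mem_univ,
    true_and, Pi.add_apply, Pi.single_apply, eq_comm (a := f)]

/-- This is connectedness of the dual graph: modulo the range, the indicators of the two faces of
any edge agree, and rotation and reversal lead from `d₀` to every dart. -/
theorem range_faceSum_sup [Finite V] (hG : G.Connected) {ρ : Perm G.Dart} (hρ : IsRotation ρ)
    (d₀ : G.Dart) :
    LinearMap.range (faceSum ρ) ⊔ Submodule.span (ZMod 2) {Pi.single (leftFace ρ d₀) 1} = ⊤ := by
  set W := LinearMap.range (faceSum ρ) ⊔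
    Submodule.span (ZMod 2) {(Pi.single (leftFace ρ d₀) 1 : Face ρ → ZMod 2)} with hW
  have hsymm : ∀ d : G.Dart, Pi.single (leftFace ρ d) 1 ∈ W → Pi.single (leftFace ρ d.symm) 1 ∈ W := by
    intro d hd
    have h1 : faceSum ρ (Pi.single (dartEdge d) 1) ∈ W :=
      Submodule.mem_sup_left (LinearMap.mem_range_self _ _)
    rw [faceSum_single] at h1
    exact (Submodule.add_mem_iff_right W hd).1 h1
  have hall : ∀ d : G.Dart, Pi.single (leftFace ρ d) 1 ∈ W := by
    refine hρ.dart_induction hG (fun d hd => ?_) hsymm (d₀ := d₀)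
      (Submodule.mem_sup_right (Submodule.mem_span_singleton_self _))
    rw [leftFace_rot]
    exact hsymm d hd
  have : Fintype (Face ρ) := Fintype.ofFinite _
  rw [eq_top_iff]
  intro t _
  rw [pi_eq_sum_univ t]
  refine Submodule.sum_mem _ fun f _ => Submodule.smul_mem _ _ ?_
  obtain ⟨d, rfl⟩ := leftFace_surjective ρ f
  convert hall d using 1
  ext g
  simp [Pi.single_apply, eq_comm]

/-- Rank-nullity for the two maps of the cochain complex; the terms `+ 1` account for the constants
in the kernel and for a cokernel of dimension at most one. Together they bound the Euler
characteristic, with equality forcing exactness in the middle. -/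
theorem card_add_card_face_le_aux [Finite V] (hG : G.Connected) {ρ : Perm G.Dart}
    (hρ : IsRotation ρ) (d₀ : G.Dart) :
    Nat.card V ≤ Module.finrank (ZMod 2) (LinearMap.range G.coboundary) + 1 ∧
    Module.finrank (ZMod 2) (LinearMap.ker (faceSum ρ)) + Nat.card (Face ρ) ≤
      Nat.card G.edgeSet + 1 := by
  have : Fintype V := Fintype.ofFinite _
  have : Fintype (Face ρ) := Fintype.ofFinite _
  have : Fintype G.edgeSet := Fintype.ofFinite _
  constructor
  · have h1 := LinearMap.finrank_range_add_finrank_ker G.coboundary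
    have h2 := (Submodule.finrank_mono (ker_coboundary_le hG)).trans (finrank_span_le_card _)
    simp only [Set.toFinset_singleton, Finset.card_singleton] at h2
    rw [Module.finrank_pi] at h1
    rw [Nat.card_eq_fintype_card]
    omega
  · have h1 := LinearMap.finrank_range_add_finrank_ker (faceSum ρ)
    rw [Module.finrank_pi] at h1
    have h2 := Submodule.finrank_add_le_finrank_add_finrank (LinearMap.range (faceSum ρ))
      (Submodule.span (ZMod 2) {Pi.single (leftFace ρ d₀) 1})
    rw [range_faceSum_sup hG hρ d₀, finrank_top, Module.finrank_pi] at h2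
    have h3 := finrank_span_le_card (R := ZMod 2)
      ({Pi.single (leftFace ρ d₀) 1} : Set (Face ρ → ZMod 2))
    simp only [Set.toFinset_singleton, Finset.card_singleton] at h3
    rw [Nat.card_eq_fintype_card, Nat.card_eq_fintype_card]
    omega

theorem range_coboundary_le {ρ : Perm G.Dart} (hρ : IsRotation ρ) :
    LinearMap.range G.coboundary ≤ LinearMap.ker (faceSum ρ) := by
  rintro _ ⟨s, rfl⟩
  exact faceSum_coboundary hρ s

/-- The Euler characteristic of a connected rotation system is at most 2. -/
theorem card_add_card_face_le [Finite V] (hG : G.Connected) {ρ : Perm G.Dart}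
    (hρ : IsRotation ρ) (d₀ : G.Dart) :
    Nat.card V + Nat.card (Face ρ) ≤ Nat.card G.edgeSet + 2 := by
  obtain ⟨h1, h2⟩ := card_add_card_face_le_aux hG hρ d₀
  have := Submodule.finrank_mono (range_coboundary_le hρ)
  omega

/-- On the sphere, a 1-cochain modulo 2 which vanishes on all face boundaries is a coboundary. -/
theorem exists_coboundary_of_faceSum_eq_zero [Finite V] (hG : G.Connected) {ρ : Perm G.Dart}
    (hρ : IsRotation ρ) (d₀ : G.Dart)
    (hχ : Nat.card V + Nat.card (Face ρ) = Nat.card G.edgeSet + 2)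
    {x : G.edgeSet → ZMod 2} (hx : faceSum ρ x = 0) : ∃ s, G.coboundary s = x := by
  obtain ⟨h1, h2⟩ := card_add_card_face_le_aux hG hρ d₀
  have h := Submodule.eq_of_le_of_finrank_le (range_coboundary_le hρ) (by omega)
  exact LinearMap.mem_range.1 (h ▸ LinearMap.mem_ker.2 hx)

end Boundary

end SimpleGraph

/-! ### Reversing rotations, facial walks, and the sign of a permutation. -/

namespace SimpleGraph

open Equiv

variable {V : Type*} {G : SimpleGraph V}

theorem IsRotation.fst_zpow {ρ : Perm G.Dart} (hρ : IsRotation ρ) (n : ℤ) (d : G.Dart) :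
    ((ρ ^ n) d).fst = d.fst :=
  ((hρ d.fst).1.perm_zpow n).mapsTo (rfl : d.fst = d.fst)

/-- The rotation that is reversed at the vertices where `o` is `-1`. -/
def IsRotation.flip {ρ : Perm G.Dart} (hρ : IsRotation ρ) (o : V → ℤˣ) : Perm G.Dart where
  toFun d := (ρ ^ (o d.fst : ℤ)) d
  invFun d := (ρ ^ (-(o d.fst : ℤ))) d
  left_inv d := by
    simp only [hρ.fst_zpow]
    rw [← Perm.mul_apply, ← zpow_add]
    simp
  right_inv d := by
    simp only [hρ.fst_zpow]
    rw [← Perm.mul_apply, ← zpow_add]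
    simp

theorem IsRotation.flip_apply {ρ : Perm G.Dart} (hρ : IsRotation ρ) (o : V → ℤˣ) (d : G.Dart) :
    hρ.flip o d = (ρ ^ (o d.fst : ℤ)) d := rfl

theorem IsRotation.flip_symm_apply {ρ : Perm G.Dart} (hρ : IsRotation ρ) (o : V → ℤˣ)
    (d : G.Dart) : (hρ.flip o)⁻¹ d = (ρ ^ (-(o d.fst : ℤ))) d := rfl

@[simp] theorem IsRotation.flip_one {ρ : Perm G.Dart} (hρ : IsRotation ρ) :
    hρ.flip 1 = ρ := by
  ext1 d; simp [IsRotation.flip_apply]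

theorem IsRotation.isRotation_flip [Finite V] {ρ : Perm G.Dart} (hρ : IsRotation ρ)
    (o : V → ℤˣ) : IsRotation (hρ.flip o) := by
  intro v
  have hfst : ∀ d : G.Dart, (hρ.flip o d).fst = d.fst := fun d => hρ.fst_zpow _ _
  refine ⟨⟨fun d hd => (hfst d).trans hd, (hρ.flip o).injective.injOn, fun d hd => ?_⟩, ?_⟩
  · refine ⟨(hρ.flip o)⁻¹ d, ?_, (hρ.flip o).apply_symm_apply d⟩
    exact (hρ.fst_zpow (-(o d.fst : ℤ)) d).trans hd
  · intro d hd d' hd'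
    have hc : (ρ ^ (o v : ℤ)).IsCycleOn {d : G.Dart | d.fst = v} := by
      rcases Int.units_eq_one_or (o v) with h | h <;> simp [h, hρ v]
    obtain ⟨n, rfl⟩ := hc.exists_pow_eq' (Set.toFinite _) hd hd'
    refine ⟨n, ?_⟩
    rw [zpow_natCast]
    have : ∀ n : ℕ, (hρ.flip o ^ n) d = ((ρ ^ (o v : ℤ)) ^ n) d ∧
        (((ρ ^ (o v : ℤ)) ^ n) d).fst = v := by
      intro n
      induction n with
      | zero => exact ⟨rfl, hd⟩
      | succ n ih =>
        rw [pow_succ', pow_succ', Perm.mul_apply, Perm.mul_apply, ih.1, hρ.flip_apply, ih.2,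
          hρ.fst_zpow]
        exact ⟨rfl, ih.2⟩
    exact (this n).1

namespace CellularEmbedding

/-- The cells of an orientable embedding are the faces of the coherently oriented rotation. -/
theorem card_cell_eq [Finite V] (e : G.CellularEmbedding) (o : V → ℤˣ)
    (ho : ∀ d : G.Dart, e.dartSig d = o d.fst * o d.snd) (hρ : IsRotation e.rot) :
    Nat.card e.Cell = Nat.card (Face (hρ.flip o)) := by
  classical
  set ρ := hρ.flip o with hρdef
  -- A state whose sign agrees with `o` runs with the face on the left of its dart in `ρ`; any other
  -- state runs backwards along the face on the left of the reversed dart.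
  let g : G.Dart × ℤˣ → Face ρ := fun x =>
    if x.2 = o x.1.fst then leftFace ρ x.1 else leftFace ρ x.1.symm
  have hpos : ∀ d, e.next (d, o d.fst) = (facePerm ρ d, o (facePerm ρ d).fst) := by
    intro d
    have h1 : (facePerm ρ d).fst = d.snd := (hρ.fst_zpow _ _)
    have h2 : o d.fst * e.dartSig d = o d.snd := by
      rw [ho, ← mul_assoc, Int.units_mul_self, one_mul]
    rw [h1]
    simp only [next, h2, facePerm_apply]
    rfl
  have hneg : ∀ d, e.next (d, -o d.fst) = (ρ⁻¹ d.symm, -o d.snd) := by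
    intro d
    have h2 : -o d.fst * e.dartSig d = -o d.snd := by
      rw [ho, ← mul_assoc, neg_mul, Int.units_mul_self, neg_mul, one_mul]
    simp only [next, h2, hρdef, hρ.flip_symm_apply]
    rfl
  have hcase : ∀ x : G.Dart × ℤˣ, x = (x.1, o x.1.fst) ∨ x = (x.1, -o x.1.fst) := by
    rintro ⟨d, ε⟩
    simp only [Prod.mk.injEq, true_and]
    exact Int.units_eq_one_or ε |>.elim
      (fun h => by rcases Int.units_eq_one_or (o d.fst) with h' | h' <;> simp [h, h'])
      (fun h => by rcases Int.units_eq_one_or (o d.fst) with h' | h' <;> simp [h, h'])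
  have hne : ∀ u : ℤˣ, -u ≠ u := by decide
  have hgpos : ∀ d, g (d, o d.fst) = leftFace ρ d := fun d => by simp [g]
  have hgneg : ∀ d, g (d, -o d.fst) = leftFace ρ d.symm := fun d => by simp [g, hne]
  have hrevpos : ∀ d, e.reverse (d, o d.fst) = (d.symm, -o d.snd) := by
    intro d
    simp only [reverse, ho, ← mul_assoc, Int.units_mul_self, one_mul]
  have hrevneg : ∀ d, e.reverse (d, -o d.fst) = (d.symm, o d.snd) := by
    intro d
    simp only [reverse, ho, ← mul_assoc, neg_mul, Int.units_mul_self, one_mul, neg_neg]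
  have hg : ∀ x y, (y = e.next x ∨ y = e.reverse x) → g x = g y := by
    intro x y hxy
    rcases hcase x with hx | hx <;> rw [hx] at hxy ⊢ <;> rcases hxy with rfl | rfl
    · rw [hpos, hgpos, hgpos, leftFace_facePerm]
    · have h := hgneg x.1.symm
      rw [Dart.symm_symm] at h
      rw [hrevpos, hgpos, ← h]
      rfl
    · rw [hneg, hgneg]
      have hf : (ρ⁻¹ x.1.symm).fst = x.1.snd := hρ.fst_zpow (-(o x.1.symm.fst : ℤ)) _
      rw [← hf, hgneg, ← leftFace_rot ρ (ρ⁻¹ x.1.symm)]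
      exact congrArg _ (ρ.apply_symm_apply _).symm
    · rw [hrevneg, hgneg, ← hgpos]; rfl
  refine Nat.card_congr (Equiv.ofBijective (Quot.lift g hg) ⟨?_, ?_⟩)
  · have hmk : ∀ c : e.Cell, ∃ d, c = Quot.mk _ (d, o d.fst) := by
      intro c
      obtain ⟨x, rfl⟩ := Quot.exists_rep c
      rcases hcase x with hx | hx
      · exact ⟨x.1, by rw [← hx]⟩
      · refine ⟨x.1.symm, Quot.sound (Or.inr ?_)⟩
        rw [hx, hrevneg]; rfl
    intro c c' h
    obtain ⟨d, rfl⟩ := hmk c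
    obtain ⟨d', rfl⟩ := hmk c'
    change g _ = g _ at h
    rw [hgpos, hgpos, leftFace_eq_iff] at h
    obtain ⟨n, -, rfl⟩ := h.exists_pow_eq'
    clear h
    induction n with
    | zero => rfl
    | succ n ih =>
      rw [ih, pow_succ', Perm.mul_apply, ← hpos]
      exact Quot.sound (Or.inl rfl)
  · intro f
    obtain ⟨d, rfl⟩ := leftFace_surjective ρ f
    exact ⟨Quot.mk _ (d, o d.fst), hgpos d⟩

theorem support_traceWalk (e : G.CellularEmbedding) (n : ℕ) (x : G.Dart × ℤˣ) :
    (e.traceWalk n x).support = (List.range (n + 1)).map fun i => (e.next^[i] x).1.fst := by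
  induction n generalizing x with
  | zero => rfl
  | succ n ih =>
    rw [List.range_succ_eq_map, List.map_cons, List.map_map]
    exact congrArg (_ :: ·) (ih _)

theorem edges_traceWalk (e : G.CellularEmbedding) (n : ℕ) (x : G.Dart × ℤˣ) :
    (e.traceWalk n x).edges =
      (List.range n).map fun i => s((e.next^[i] x).1.fst, (e.next^[i + 1] x).1.fst) := by
  induction n generalizing x with
  | zero => rfl
  | succ n ih =>
    rw [List.range_succ_eq_map, List.map_cons, List.map_map]
    exact congrArg (_ :: ·) (ih _)

/-- A facial walk that does not repeat vertices and has length at least 3 is a cycle. -/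
theorem isCycle_facialWalk (e : G.CellularEmbedding) {x : G.Dart × ℤˣ}
    (hper : x ∈ Function.periodicPts e.next)
    (hinj : ∀ i j, (e.next^[i] x).1.fst = (e.next^[j] x).1.fst → e.next^[i] x = e.next^[j] x)
    (htwo : e.next^[2] x ≠ x) : (e.facialWalk x).IsCycle := by
  have closed : ∀ {w : V} (p : G.Walk (e.next x).1.fst w) (h : w = x.1.fst), p.support.Nodup →
      s(x.1.fst, (e.next x).1.fst) ∉ p.edges →
      ((Walk.cons (e.adj_next x) p).copy rfl h).IsCycle := by
    rintro w p rfl h1 h2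
    exact (Walk.cons_isCycle_iff _ _).2 ⟨(Walk.isPath_def _).2 h1, h2⟩
  have key : ∀ m, Function.minimalPeriod e.next x = m → ∀ h : (e.next^[m] x).1.fst = x.1.fst,
      ((e.traceWalk m x).copy rfl h).IsCycle := by
    intro m hn h
    obtain ⟨n, rfl⟩ := Nat.exists_eq_add_one.2
      (hn ▸ Function.minimalPeriod_pos_of_mem_periodicPts hper)
    have hmin : e.next^[n + 1] x = x := by rw [← hn, Function.iterate_minimalPeriod]
    have hlt : ∀ i j, i < n + 1 → j < n + 1 → e.next^[i] x = e.next^[j] x → i = j := by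
      intro i j hi hj hij
      exact (Function.iterate_eq_iterate_iff_of_lt_minimalPeriod (hn ▸ hi) (hn ▸ hj)).1 hij
    refine closed (e.traceWalk n (e.next x)) h ?_ ?_
    · rw [support_traceWalk]
      refine List.Nodup.map_on ?_ List.nodup_range
      intro i hi j hj hij
      rw [List.mem_range] at hi hj
      rw [← Function.iterate_succ_apply, ← Function.iterate_succ_apply] at hij
      have h2 := hinj _ _ hij
      -- The support of the tail uses the indices 1 to `n + 1`; the last one is `x` again and is
      -- compared as index 0.
      rcases Nat.lt_or_ge (i + 1) (n + 1) with hi' | hi' <;>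
        rcases Nat.lt_or_ge (j + 1) (n + 1) with hj' | hj'
      · have := hlt _ _ hi' hj' h2
        omega
      · obtain rfl : j = n := by omega
        have := hlt (i + 1) 0 hi' (by omega) (h2.trans hmin)
        omega
      · obtain rfl : i = n := by omega
        have := hlt (j + 1) 0 hj' (by omega) (h2.symm.trans hmin)
        omega
      · omega
    · intro hmem
      rw [edges_traceWalk] at hmem
      obtain ⟨i, hi, hE⟩ := List.mem_map.1 hmem
      rw [List.mem_range] at hi
      rw [← Function.iterate_succ_apply, ← Function.iterate_succ_apply] at hE
      rcases Sym2.eq_iff.1 hE with ⟨h1, -⟩ | ⟨h1, h2⟩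
      -- A repeated first edge in the same direction would make the state recur before its period;
      -- in the opposite direction it would give a face of length two, excluded by `htwo`.
      · have := hlt (i + 1) 0 (by omega) (by omega) (hinj (i + 1) 0 h1)
        omega
      · have h3 := hinj (i + 1) 1 h1
        have h4 := hinj (i + 1 + 1) 0 h2
        rw [Function.iterate_succ_apply', h3] at h4
        exact htwo h4
  exact key _ rfl _

/-- The embedding without twisted edges given by a rotation. -/
def ofRotation {ρ : Perm G.Dart} (hρ : IsRotation ρ) : G.CellularEmbedding where
  rot := ρ
  rot_isCycleOn := hρ
  sig := 1

theorem dartSig_ofRotation {ρ : Perm G.Dart} (hρ : IsRotation ρ) (d : G.Dart) :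
    (ofRotation hρ).dartSig d = 1 := rfl

theorem isOrientable_ofRotation {ρ : Perm G.Dart} (hρ : IsRotation ρ) :
    (ofRotation hρ).IsOrientable :=
  ⟨1, fun _ => rfl⟩

theorem card_cell_ofRotation [Finite V] {ρ : Perm G.Dart} (hρ : IsRotation ρ) :
    Nat.card (ofRotation hρ).Cell = Nat.card (Face ρ) := by
  refine (card_cell_eq (ofRotation hρ) 1 (fun _ => rfl) hρ).trans ?_
  exact congrArg (fun σ => Nat.card (Face σ)) (IsRotation.flip_one hρ)

theorem next_ofRotation_iterate_one {ρ : Perm G.Dart} (hρ : IsRotation ρ) (n : ℕ) (d : G.Dart) :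
    (ofRotation hρ).next^[n] (d, 1) = ((facePerm ρ ^ n) d, 1) := by
  induction n with
  | zero => rfl
  | succ n ih =>
    rw [Function.iterate_succ_apply', ih, pow_succ', Perm.mul_apply]
    simp only [next, dartSig_ofRotation, mul_one, Units.val_one, zpow_one]
    rfl

theorem next_ofRotation_iterate_neg_one {ρ : Perm G.Dart} (hρ : IsRotation ρ) (n : ℕ)
    (d : G.Dart) : (ofRotation hρ).next^[n] (d, -1) = ((((facePerm ρ)⁻¹ ^ n) d.symm).symm, -1) := by
  induction n with
  | zero => simp
  | succ n ih =>
    rw [Function.iterate_succ_apply', ih, pow_succ', Perm.mul_apply]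
    simp only [next, dartSig_ofRotation, mul_one, Units.val_neg, Units.val_one, zpow_neg, zpow_one,
      Dart.symm_symm, Prod.mk.injEq, and_true]
    change ρ⁻¹ _ = _
    rw [Perm.inv_eq_iff_eq, ← facePerm_apply]
    exact ((facePerm ρ).apply_symm_apply _).symm

theorem isStrong_ofRotation [Finite V] {ρ : Perm G.Dart} (hρ : IsRotation ρ)
    (hne : ∀ d, ρ d ≠ d)
    (hinj : ∀ d d' : G.Dart, leftFace ρ d = leftFace ρ d' → d.fst = d'.fst → d = d') :
    (ofRotation hρ).IsStrong := by
  have htwo : ∀ d, (facePerm ρ ^ 2) d ≠ d := by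
    intro d h
    rw [pow_two, Perm.mul_apply] at h
    have h1 : facePerm ρ d = d.symm := by
      apply Dart.ext
      refine Prod.ext (hρ.fst_facePerm d) ?_
      change (facePerm ρ d).snd = d.fst
      rw [← hρ.fst_facePerm, h]
    exact hne _ h1
  have hord : ∀ σ : Perm G.Dart, ∃ n > 0, σ ^ n = 1 := fun σ =>
    ⟨orderOf σ, orderOf_pos σ, pow_orderOf_eq_one σ⟩
  rintro ⟨d, ε⟩
  rcases Int.units_eq_one_or ε with rfl | rfl
  · apply isCycle_facialWalk
    · obtain ⟨n, hn, h⟩ := hord (facePerm ρ)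
      refine Function.mk_mem_periodicPts hn ?_
      rw [Function.IsPeriodicPt, Function.IsFixedPt, next_ofRotation_iterate_one, h]
      rfl
    · intro i j h
      rw [next_ofRotation_iterate_one, next_ofRotation_iterate_one] at h ⊢
      exact congrArg (·, 1) (hinj _ _ (by rw [leftFace_facePerm_pow, leftFace_facePerm_pow]) h)
    · intro h
      rw [next_ofRotation_iterate_one] at h
      exact htwo d (Prod.ext_iff.1 h).1
  · apply isCycle_facialWalk
    · obtain ⟨n, hn, h⟩ := hord (facePerm ρ)⁻¹
      refine Function.mk_mem_periodicPts hn ?_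
      rw [Function.IsPeriodicPt, Function.IsFixedPt, next_ofRotation_iterate_neg_one, h]
      simp
    · intro i j h
      rw [next_ofRotation_iterate_neg_one, next_ofRotation_iterate_neg_one] at h ⊢
      -- Read backwards, the initial vertex of the state is the terminal vertex of a face dart. One
      -- application of `facePerm ρ` makes it an initial vertex, where `hinj` applies.
      have h1 : ((facePerm ρ) (((facePerm ρ)⁻¹ ^ i) d.symm)).fst =
          ((facePerm ρ) (((facePerm ρ)⁻¹ ^ j) d.symm)).fst := by
        rw [hρ.fst_facePerm, hρ.fst_facePerm]; exact h
      have h2 : ∀ k : ℕ, leftFace ρ ((facePerm ρ) (((facePerm ρ)⁻¹ ^ k) d.symm)) =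
          leftFace ρ d.symm := by
        intro k
        rw [leftFace_facePerm, leftFace_eq_iff, inv_pow, ← zpow_natCast, ← zpow_neg]
        exact Perm.sameCycle_zpow_left.2 (Perm.SameCycle.refl _ _)
      rw [(facePerm ρ).injective (hinj _ _ ((h2 i).trans (h2 j).symm) h1)]
    · intro h
      rw [next_ofRotation_iterate_neg_one] at h
      have h1 := (Prod.ext_iff.1 h).1
      have h2 : ((facePerm ρ)⁻¹ ^ 2) d.symm = d.symm := by
        simpa using congrArg Dart.symm h1
      rw [inv_pow, Perm.inv_eq_iff_eq] at h2
      exact htwo _ h2.symm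

end CellularEmbedding

/-- The sign of a permutation without fixed points is determined by the parity of the number of
its cycles. -/
theorem sign_eq_neg_one_pow_card {α : Type*} [Fintype α] [DecidableEq α] (σ : Perm α)
    (hσ : ∀ a, σ a ≠ a) :
    Perm.sign σ = (-1) ^ (Fintype.card α + Nat.card (Quotient (Perm.SameCycle.setoid σ))) := by
  have hsupp : σ.support = Finset.univ := by ext a; simp [hσ]
  have hcard : Nat.card (Quotient (Perm.SameCycle.setoid σ)) = σ.cycleFactorsFinset.card := by
    rw [← Fintype.card_coe, ← Nat.card_eq_fintype_card]
    have hmem : ∀ a, σ.cycleOf a ∈ σ.cycleFactorsFinset := fun a =>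
      Perm.cycleOf_mem_cycleFactorsFinset_iff.2 (by simp [hσ])
    refine Nat.card_congr (Equiv.ofBijective
      (Quotient.lift (fun a => (⟨σ.cycleOf a, hmem a⟩ : σ.cycleFactorsFinset))
        fun a b h => Subtype.ext (Perm.SameCycle.cycleOf_eq h)) ⟨?_, ?_⟩)
    · intro p q
      induction p using Quotient.inductionOn with | h a =>
      induction q using Quotient.inductionOn with | h b =>
      intro h
      have h' : σ.cycleOf a = σ.cycleOf b := congrArg Subtype.val h
      exact Quotient.sound ((Perm.sameCycle_iff_cycleOf_eq_of_mem_support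
        (by simp [hσ]) (by simp [hσ])).2 h')
    · rintro ⟨c, hc⟩
      obtain ⟨a, ha⟩ := Perm.IsCycle.nonempty_support (Perm.mem_cycleFactorsFinset_iff.1 hc).1
      exact ⟨Quotient.mk _ a, Subtype.ext (Perm.cycle_is_cycleOf ha hc).symm⟩
  rw [Perm.sign_of_cycleType, Perm.sum_cycleType, hsupp, Finset.card_univ, hcard,
    Perm.cycleType_def, Multiset.card_map]
  rfl

end SimpleGraph

/-! ### Small edge cuts and short dual cycles. -/

namespace SimpleGraph

open Equiv

variable {V : Type*} {G : SimpleGraph V}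

/-- A finite forest has fewer edges than vertices. -/
theorem IsAcyclic.card_edgeSet_lt [Finite V] [Nonempty V] (h : G.IsAcyclic) :
    Nat.card G.edgeSet < Nat.card V := by
  classical
  have : Fintype V := Fintype.ofFinite V
  -- The forest extends to a maximal acyclic graph on all of `V`, which is a spanning tree of the
  -- complete graph.
  obtain ⟨T, hle, hT⟩ := (Set.toFinite {H : SimpleGraph V | H.IsAcyclic}).exists_le_maximal h
  have htree : T.IsTree := isTree_iff_maximal_isAcyclic.2 ⟨inferInstance, hT⟩
  have h1 := htree.card_edgeFinset
  have h2 : Nat.card G.edgeSet ≤ Nat.card T.edgeSet :=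
    Nat.card_mono (Set.toFinite _) (edgeSet_mono hle)
  rw [Nat.card_eq_fintype_card (α := T.edgeSet), ← edgeFinset_card] at h2
  rw [Nat.card_eq_fintype_card (α := V)]
  omega

variable [Fintype V] [DecidableRel G.Adj]

/-- In a cubic graph, a set of at least two vertices with at most three outgoing edges induces a
cycle. -/
theorem not_isAcyclic_induce (hcubic : G.IsRegularOfDegree 3) {S : Set V} (hS : S.Nontrivial)
    {A : Finset (Sym2 V)} (hcard : A.card ≤ 3)
    (hcut : ∀ d : G.Dart, d.fst ∈ S → d.snd ∉ S → d.edge ∈ A) : ¬ (G.induce S).IsAcyclic := by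
  classical
  intro hac
  have : Nonempty S := hS.nonempty.to_subtype
  have h1 := hac.card_edgeSet_lt
  have h2 : 2 ≤ Fintype.card S := by
    have := hS.coe_sort
    exact Fintype.one_lt_card
  have h3 := (G.induce S).dart_card_eq_twice_card_edges
  rw [Nat.card_eq_fintype_card, Nat.card_eq_fintype_card, ← edgeFinset_card] at h1
  have h4 : (Finset.univ.filter fun d : G.Dart => d.fst ∈ S).card = Fintype.card S * 3 := by
    rw [← Set.toFinset_card S]
    rw [Finset.card_eq_sum_card_fiberwise (f := fun d : G.Dart => d.fst) (t := S.toFinset)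
      (fun d hd => by simpa using hd), Finset.sum_const_nat]
    intro v hv
    have h := G.dart_fst_fiber_card_eq_degree v
    rw [hcubic.degree_eq] at h
    rw [← h, Finset.filter_filter]
    congr 1
    ext d
    simp only [Finset.mem_filter, Finset.mem_univ, true_and, and_iff_right_iff_imp]
    rintro rfl
    exact Set.mem_toFinset.1 hv
  have h5 := Finset.card_filter_add_card_filter_not
    (s := Finset.univ.filter fun d : G.Dart => d.fst ∈ S) (fun d => d.snd ∈ S)
  have h6 : ((Finset.univ.filter fun d : G.Dart => d.fst ∈ S).filter fun d => d.snd ∈ S).card ≤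
      Fintype.card (G.induce S).Dart := by
    rw [← Finset.card_univ]
    refine Finset.card_le_card_of_surjOn
      (fun d : (G.induce S).Dart => (⟨(d.fst, d.snd), d.adj⟩ : G.Dart)) ?_
    intro d hd
    simp only [Finset.coe_filter, Finset.mem_filter, Finset.mem_univ, true_and,
      Set.mem_ofPred_eq] at hd
    exact ⟨⟨(⟨d.fst, hd.1⟩, ⟨d.snd, hd.2⟩), d.adj⟩, Finset.mem_coe.2 (Finset.mem_univ _), rfl⟩
  have h7 : ((Finset.univ.filter fun d : G.Dart => d.fst ∈ S).filter fun d => ¬ d.snd ∈ S).card ≤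
      A.card := by
    refine Finset.card_le_card_of_injOn (fun d => d.edge) ?_ ?_
    · intro d hd
      simp only [Finset.coe_filter, Finset.mem_filter, Finset.mem_univ, true_and,
        Set.mem_ofPred_eq] at hd
      exact hcut d hd.1 hd.2
    · intro d hd d' hd' h
      simp only [Finset.coe_filter, Finset.mem_filter, Finset.mem_univ, true_and,
        Set.mem_ofPred_eq] at hd hd'
      rcases (dart_edge_eq_iff d d').1 h with h | rfl
      · exact h
      · exact absurd hd.1 hd'.2
  -- With `n = |S|`, counting the darts that start in `S` gives `3n ≤ 2(n - 1) + 3`, so `n ≤ 1`.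
  omega

/-- An edge cut with at most three edges in a cyclically 4-edge-connected cubic graph has a side
with at most one vertex. -/
theorem subsingleton_or_compl_subsingleton_of_cut (hcubic : G.IsRegularOfDegree 3)
    (hcyc : G.IsCyclicallyEdgeConnected 4) {S : Set V} {A : Finset (Sym2 V)}
    (hA : (A : Set (Sym2 V)) ⊆ G.edgeSet) (hcard : A.card ≤ 3)
    (hcut : ∀ d : G.Dart, d.edge ∈ A ↔ ¬ (d.fst ∈ S ↔ d.snd ∈ S)) :
    S.Subsingleton ∨ Sᶜ.Subsingleton := by
  classical
  by_contra hcon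
  rw [not_or, Set.not_subsingleton_iff, Set.not_subsingleton_iff] at hcon
  have hinv : ∀ u v, (G.deleteEdges (A : Set (Sym2 V))).Reachable u v → (u ∈ S ↔ v ∈ S) := by
    rintro u v ⟨p⟩
    induction p with
    | nil => rfl
    | cons h p ih =>
      refine Iff.trans ?_ ih
      rw [deleteEdges_adj] at h
      have := (hcut ⟨(_, _), h.1⟩).not.1 h.2
      simpa using this
  have cyc : ∀ T : Set V, T.Nontrivial → (∀ d : G.Dart, d.edge ∈ A ↔ ¬ (d.fst ∈ T ↔ d.snd ∈ T)) →
      ∃ v ∈ T, ∃ w : (G.deleteEdges (A : Set (Sym2 V))).Walk v v, w.IsCycle := by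
    intro T hT hcutT
    have hac := not_isAcyclic_induce hcubic hT hcard fun d h1 h2 => (hcutT d).2 (by tauto)
    simp only [IsAcyclic, not_forall, not_not] at hac
    obtain ⟨v, w, hw⟩ := hac
    let f : G.induce T →g G.deleteEdges (A : Set (Sym2 V)) :=
      ⟨Subtype.val, fun {a b} hab => by
        rw [deleteEdges_adj]
        refine ⟨hab, fun hmem => ?_⟩
        exact (hcutT ⟨(a, b), hab⟩).1 hmem (by simp)⟩
    exact ⟨v, v.2, w.map f, hw.map Subtype.val_injective⟩
  obtain ⟨v₁, h₁, c₁⟩ := cyc S hcon.1 hcut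
  obtain ⟨v₂, h₂, c₂⟩ := cyc Sᶜ hcon.2 fun d => (hcut d).trans (by simp only [Set.mem_compl_iff]; tauto)
  refine hcyc A hA (by omega) ⟨connectedComponentMk _ v₁, connectedComponentMk _ v₂, ?_,
    ⟨v₁, rfl, c₁⟩, ⟨v₂, rfl, c₂⟩⟩
  intro h
  exact h₂ ((hinv _ _ (ConnectedComponent.exact h)).1 h₁)

/-- The darts at a vertex of a cubic graph. -/
theorem IsRotation.cubic (hcubic : G.IsRegularOfDegree 3) {ρ : Perm G.Dart} (hρ : IsRotation ρ)
    (d : G.Dart) : ρ d ≠ d ∧ ρ (ρ d) ≠ d ∧ ρ (ρ (ρ d)) = d ∧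
      ∀ d' : G.Dart, d'.fst = d.fst → d' = d ∨ d' = ρ d ∨ d' = ρ (ρ d) := by
  classical
  have hc : ρ.IsCycleOn (Finset.univ.filter fun d' : G.Dart => d'.fst = d.fst : Finset G.Dart) := by
    simpa using hρ d.fst
  have hcard : (Finset.univ.filter fun d' : G.Dart => d'.fst = d.fst : Finset G.Dart).card = 3 := by
    have h := G.dart_fst_fiber_card_eq_degree d.fst
    rw [hcubic.degree_eq] at h
    convert h
  have hd : d ∈ (Finset.univ.filter fun d' : G.Dart => d'.fst = d.fst : Finset G.Dart) := by simp
  have hp : ∀ n, (ρ ^ n) d = d ↔ 3 ∣ n := fun n => hcard ▸ hc.pow_apply_eq hd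
  refine ⟨fun h => ?_, fun h => ?_, (hp 3).2 dvd_rfl, fun d' hd' => ?_⟩
  · have := (hp 1).1 h
    omega
  · have := (hp 2).1 h
    omega
  · obtain ⟨n, hn, rfl⟩ := hc.exists_pow_eq hd (by simpa using hd')
    rw [hcard] at hn
    interval_cases n
    · exact Or.inl rfl
    · exact Or.inr (Or.inl rfl)
    · exact Or.inr (Or.inr rfl)

open scoped Classical in
/-- On the sphere, the edges crossed by a closed curve (a 1-cycle of the dual graph) form an edge
cut. -/
theorem exists_cut_of_dual_cycle (hG : G.Connected) {ρ : Perm G.Dart} (hρ : IsRotation ρ)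
    (hχ : Nat.card V + Nat.card (Face ρ) = Nat.card G.edgeSet + 2) (d₀ : G.Dart)
    {l : List G.Dart} (hnodup : (l.map dartEdge).Nodup)
    (hsum : (l.map fun a => (Pi.single (leftFace ρ a) 1 + Pi.single (leftFace ρ a.symm) 1 :
      Face ρ → ZMod 2)).sum = 0) :
    ∃ S : Set V, ∀ d : G.Dart, dartEdge d ∈ l.map dartEdge ↔ ¬ (d.fst ∈ S ↔ d.snd ∈ S) := by
  -- This is the indicator cochain of the crossed edges; since it is the coboundary of some `s`, the
  -- side `S` is a level set of `s`.
  let x : G.edgeSet → ZMod 2 := (l.map fun a => Pi.single (dartEdge a) 1).sum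
  have hx : faceSum ρ x = 0 := by
    rw [map_list_sum, List.map_map, ← hsum]
    congr 1
    exact List.map_congr_left fun a _ => faceSum_single ρ a
  have hxe : ∀ e, x e = if e ∈ l.map dartEdge then 1 else 0 := by
    intro e
    have : ∀ l' : List G.edgeSet, l'.Nodup →
        (l'.map fun a => (Pi.single a 1 : G.edgeSet → ZMod 2)).sum e =
          if e ∈ l' then 1 else 0 := by
      intro l' hl'
      induction l' with
      | nil => rfl
      | cons a l' ih =>
        rw [List.nodup_cons] at hl'
        rw [List.map_cons, List.sum_cons, Pi.add_apply, ih hl'.2, Pi.single_apply]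
        by_cases h : e = a
        · subst h; simp [hl'.1]
        · simp [h]
    rw [← this _ hnodup, List.map_map]
    rfl
  obtain ⟨s, hs⟩ := exists_coboundary_of_faceSum_eq_zero hG hρ d₀ hχ hx
  refine ⟨{v | s v = 1}, fun d => ?_⟩
  have h1 := hxe (dartEdge d)
  rw [← hs, coboundary_dartEdge] at h1
  have h2 : ∀ a b : ZMod 2, (a + b = 1 ↔ ¬ (a = 1 ↔ b = 1)) := by decide
  rw [Set.mem_ofPred_eq, Set.mem_ofPred_eq, ← h2, h1]
  split_ifs with h <;> simp [h]

/-- The properties of the spherical rotation of a cubic graph on which the construction rests: all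
vertices have three darts, no face is incident to both sides of an edge, two faces share at most
one edge, and three pairwise adjacent faces meet in a vertex. -/
structure IsTightRotation (ρ : Perm G.Dart) : Prop where
  isRotation : IsRotation ρ
  rot_rot_rot : ∀ d, ρ (ρ (ρ d)) = d
  rot_ne : ∀ d, ρ d ≠ d
  eq_or_eq_rot : ∀ d d' : G.Dart, d'.fst = d.fst → d' = d ∨ d' = ρ d ∨ d' = ρ (ρ d)
  leftFace_ne : ∀ d, leftFace ρ d ≠ leftFace ρ d.symm
  eq_of_leftFace_eq : ∀ a b, leftFace ρ a = leftFace ρ b → leftFace ρ a.symm = leftFace ρ b.symm →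
    a = b
  exists_common_vertex : ∀ a b c, leftFace ρ a.symm = leftFace ρ b →
    leftFace ρ b.symm = leftFace ρ c → leftFace ρ c.symm = leftFace ρ a →
    ∃ v, (a.fst = v ∨ a.snd = v) ∧ (b.fst = v ∨ b.snd = v) ∧ (c.fst = v ∨ c.snd = v)

open scoped Classical in
/-- A closed curve crossing at most three edges encircles a single vertex. -/
theorem exists_vertex_of_dual_cycle (hG : G.Connected) (hcubic : G.IsRegularOfDegree 3)
    (hcyc : G.IsCyclicallyEdgeConnected 4) {ρ : Perm G.Dart} (hρ : IsRotation ρ)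
    (hχ : Nat.card V + Nat.card (Face ρ) = Nat.card G.edgeSet + 2)
    {l : List G.Dart} (hne : l ≠ []) (hlen : l.length ≤ 3) (hnodup : (l.map dartEdge).Nodup)
    (hsum : (l.map fun a => (Pi.single (leftFace ρ a) 1 + Pi.single (leftFace ρ a.symm) 1 :
      Face ρ → ZMod 2)).sum = 0) :
    3 ≤ l.length ∧ ∃ v, ∀ a ∈ l, a.fst = v ∨ a.snd = v := by
  obtain ⟨d₀, hd₀⟩ := List.exists_mem_of_ne_nil l hne
  obtain ⟨S, hS⟩ := exists_cut_of_dual_cycle hG hρ hχ d₀ hnodup hsum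
  have hmem : ∀ d : G.Dart, d.edge ∈ (l.map Dart.edge).toFinset ↔ dartEdge d ∈ l.map dartEdge := by
    intro d
    rw [List.mem_toFinset, List.mem_map, List.mem_map]
    simp only [dartEdge, Subtype.mk.injEq]
  have hsub := subsingleton_or_compl_subsingleton_of_cut hcubic hcyc (S := S)
    (A := (l.map Dart.edge).toFinset) (by
      intro e he
      rw [Finset.mem_coe, List.mem_toFinset, List.mem_map] at he
      obtain ⟨d, -, rfl⟩ := he
      exact d.edge_mem)
    ((List.toFinset_card_le _).trans (by rwa [List.length_map]))
    fun d => (hmem d).trans (hS d)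
  -- The cut is nonempty, so its small side is exactly one vertex `v`, and the listed edges are
  -- exactly the star of `v`. That star has three edges, hence the lower bound on the length.
  have hv : ∃ v, ∀ d : G.Dart, dartEdge d ∈ l.map dartEdge ↔ (d.fst = v ∨ d.snd = v) := by
    have h0 := (hS d₀).1 (List.mem_map_of_mem hd₀)
    have key : ∀ T : Set V, T.Subsingleton → T.Nonempty →
        (∀ d : G.Dart, dartEdge d ∈ l.map dartEdge ↔ ¬ (d.fst ∈ T ↔ d.snd ∈ T)) →
        ∃ v, ∀ d : G.Dart, dartEdge d ∈ l.map dartEdge ↔ (d.fst = v ∨ d.snd = v) := by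
      rintro T hT ⟨v, hv⟩ hcut
      obtain rfl := hT.eq_singleton_of_mem hv
      refine ⟨v, fun d => (hcut d).trans ?_⟩
      have := d.fst_ne_snd
      rw [Set.mem_singleton_iff, Set.mem_singleton_iff]
      constructor
      · tauto
      · rintro (h | h) h' <;> simp_all
    rcases hsub with h | h
    · exact key S h (by by_contra hc; rw [Set.not_nonempty_iff_eq_empty] at hc; simp [hc] at h0) hS
    · refine key Sᶜ h ?_ fun d => (hS d).trans (by simp only [Set.mem_compl_iff]; tauto)
      by_contra hc
      rw [Set.not_nonempty_iff_eq_empty, Set.compl_empty_iff] at hc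
      simp [hc] at h0
  obtain ⟨v, hv⟩ := hv
  refine ⟨?_, v, fun a ha => (hv a).1 (List.mem_map_of_mem ha)⟩
  have hcard : (Finset.univ.filter fun d : G.Dart => d.fst = v).card = 3 := by
    have h := G.dart_fst_fiber_card_eq_degree v
    rw [hcubic.degree_eq] at h
    convert h
  rw [← hcard, ← List.length_map (as := l) dartEdge]
  refine le_trans ?_ (List.toFinset_card_le _)
  refine Finset.card_le_card_of_injOn dartEdge ?_ ?_
  · intro d hd
    rw [Finset.mem_coe, List.mem_toFinset, hv]
    exact Or.inl (by simpa using hd)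
  · intro d hd d' hd' h
    have e1 : d.fst = v := by simpa using hd
    have e2 : d'.fst = v := by simpa using hd'
    rcases dartEdge_eq_iff.1 h with h | rfl
    · exact h
    · exact absurd (e2.trans e1.symm) d'.fst_ne_snd

/-- The last three clauses concern dual closed walks of length one, two and three: the first two
lengths are too short to encircle a vertex, and the third gives the common vertex. -/
theorem isTightRotation (hG : G.Connected) (hcubic : G.IsRegularOfDegree 3)
    (hcyc : G.IsCyclicallyEdgeConnected 4) {ρ : Perm G.Dart} (hρ : IsRotation ρ)
    (hχ : Nat.card V + Nat.card (Face ρ) = Nat.card G.edgeSet + 2) : IsTightRotation ρ := by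
  classical
  have h2 : (2 : Face ρ → ZMod 2) = 0 := by ext f; rfl
  have hne : ∀ d, leftFace ρ d ≠ leftFace ρ d.symm := by
    intro d hd
    have := (exists_vertex_of_dual_cycle hG hcubic hcyc hρ hχ (l := [d]) (by simp) (by simp)
      (by simp) (by
        simp only [List.map_cons, List.map_nil, List.sum_cons, List.sum_nil, hd]
        linear_combination (Pi.single (leftFace ρ d.symm) 1) * h2)).1
    simp at this
  have hne_of : ∀ a b, leftFace ρ a.symm = leftFace ρ b → leftFace ρ b.symm ≠ leftFace ρ a →
      dartEdge a ≠ dartEdge b := by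
    intro a b h h' he
    rcases dartEdge_eq_iff.1 he with rfl | rfl
    · exact hne _ h.symm
    · exact h' rfl
  refine ⟨hρ, fun d => (hρ.cubic hcubic d).2.2.1, fun d => (hρ.cubic hcubic d).1,
    fun d => (hρ.cubic hcubic d).2.2.2, hne, ?_, ?_⟩
  · intro a b h h'
    by_contra hab
    have := (exists_vertex_of_dual_cycle hG hcubic hcyc hρ hχ (l := [a, b]) (by simp) (by simp)
      (by
        simp only [List.map_cons, List.map_nil, List.nodup_cons, List.mem_singleton,
          List.not_mem_nil, not_false_eq_true, List.nodup_nil, and_true]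
        intro he
        rcases dartEdge_eq_iff.1 he with rfl | rfl
        · exact hab rfl
        · exact hne _ h.symm) (by
        simp only [List.map_cons, List.map_nil, List.sum_cons, List.sum_nil, h, h']
        linear_combination (Pi.single (leftFace ρ b.symm) 1 + Pi.single (leftFace ρ b) 1) * h2)).1
    simp at this
  · intro a b c h1 h3 h4
    have hab := hne_of a b h1 (by rw [h3, ← h4]; exact hne c)
    have hbc := hne_of b c h3 (by rw [h4, ← h1]; exact hne a)
    have hca := hne_of c a h4 (by rw [h1, ← h3]; exact hne b)
    obtain ⟨v, hv⟩ := (exists_vertex_of_dual_cycle hG hcubic hcyc hρ hχ (l := [a, b, c]) (by simp)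
      (by simp) (by simp [hab, hbc, hca.symm]) (by
        simp only [List.map_cons, List.map_nil, List.sum_cons, List.sum_nil, h1, h3, h4]
        linear_combination (Pi.single (leftFace ρ a) 1 + Pi.single (leftFace ρ b) 1 +
          Pi.single (leftFace ρ c) 1) * h2)).2
    exact ⟨v, hv a (by simp), hv b (by simp), hv c (by simp)⟩

end SimpleGraph

/-! ### Reversing the rotation on one side of a cut. -/

namespace SimpleGraph

open Equiv

variable {V : Type*} {G : SimpleGraph V}

theorem IsRotation.facePerm_ne {ρ : Perm G.Dart} (hρ : IsRotation ρ) (d : G.Dart) :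
    facePerm ρ d ≠ d := by
  intro h
  have := hρ.fst_facePerm d
  rw [h] at this
  exact d.fst_ne_snd this

/-- The parity of the number of faces does not depend on the rotation of a cubic graph. -/
theorem card_face_mod_two [Fintype V] [DecidableRel G.Adj]
    (hcubic : G.IsRegularOfDegree 3) {ρ ρ' : Perm G.Dart} (hρ : IsRotation ρ) (hρ' : IsRotation ρ') :
    Nat.card (Face ρ) % 2 = Nat.card (Face ρ') % 2 := by
  classical
  -- A rotation of a cubic graph has cube 1 and is therefore even, so the sign of the face
  -- permutation is that of the reversal alone.
  have hsign : ∀ {σ : Perm G.Dart}, IsRotation σ → Perm.sign σ = 1 := by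
    intro σ hσ
    have h : σ ^ 3 = 1 := by
      ext1 d
      exact (hσ.cubic hcubic d).2.2.1
    have h2 := congrArg Perm.sign h
    rw [map_pow, map_one] at h2
    rcases Int.units_eq_one_or (Perm.sign σ) with h3 | h3
    · exact h3
    · rw [h3] at h2; exact absurd h2 (by decide)
  have h1 := sign_eq_neg_one_pow_card (facePerm ρ) hρ.facePerm_ne
  have h2 := sign_eq_neg_one_pow_card (facePerm ρ') hρ'.facePerm_ne
  have h3 : Perm.sign (facePerm ρ) = Perm.sign (facePerm ρ') := by
    rw [facePerm, facePerm, map_mul, map_mul, hsign hρ, hsign hρ']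
  rw [h1, h2, pow_add, pow_add, mul_right_inj] at h3
  change (-1 : ℤˣ) ^ Nat.card (Face ρ) = (-1) ^ Nat.card (Face ρ') at h3
  rcases Nat.even_or_odd (Nat.card (Face ρ)) with ha | ha <;>
    rcases Nat.even_or_odd (Nat.card (Face ρ')) with hb | hb
  · rw [Nat.even_iff.1 ha, Nat.even_iff.1 hb]
  · rw [ha.neg_one_pow, hb.neg_one_pow] at h3; exact absurd h3 (by decide)
  · rw [ha.neg_one_pow, hb.neg_one_pow] at h3; exact absurd h3 (by decide)
  · rw [Nat.odd_iff.1 ha, Nat.odd_iff.1 hb]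

section Flip

open scoped Classical

variable {ρ : Perm G.Dart}

/-- The sign function reversing the rotation exactly at the vertices in `S`. -/
noncomputable def flipSign (S : Set V) (v : V) : ℤˣ := if v ∈ S then -1 else 1

/-- The face of `ρ` containing the corner through which the face of the flipped rotation enters
the dart `d`. -/
noncomputable def cornerFace (ρ : Perm G.Dart) (S : Set V) (d : G.Dart) : Face ρ :=
  if d.fst ∈ S then leftFace ρ d.symm else leftFace ρ d

/-- Compared with the definition of `cornerFace`, only `d.fst` has become `d.snd`: the corner face
changes only along cut edges, where it moves to the other face of the edge. -/
theorem cornerFace_facePerm_flip (hρ : IsRotation ρ) (S : Set V) (d : G.Dart) :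
    cornerFace ρ S (facePerm (hρ.flip (flipSign S)) d) =
      if d.snd ∈ S then leftFace ρ d.symm else leftFace ρ d := by
  have hfst : (facePerm (hρ.flip (flipSign S)) d).fst = d.snd := hρ.fst_zpow _ _
  have h1 : facePerm (hρ.flip (flipSign S)) d = (ρ ^ (flipSign S d.snd : ℤ)) d.symm := rfl
  rw [cornerFace, hfst, h1]
  split_ifs with h
  · simp only [flipSign, h, if_true, Units.val_neg, Units.val_one, zpow_neg, zpow_one]
    rw [← leftFace_rot]
    exact congrArg _ (ρ.apply_symm_apply _)
  · simp only [flipSign, h, if_false, Units.val_one, zpow_one]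
    exact leftFace_facePerm ρ d

/-- Distinct corners at a vertex lie in the two faces of some edge. -/
theorem IsTightRotation.exists_dart_of_cornerFace (hρ : IsTightRotation ρ) (S : Set V)
    {d d' : G.Dart} (hfst : d'.fst = d.fst) (hne : d' ≠ d) :
    ∃ a : G.Dart, (leftFace ρ a = cornerFace ρ S d ∧ leftFace ρ a.symm = cornerFace ρ S d') ∨
      (leftFace ρ a = cornerFace ρ S d' ∧ leftFace ρ a.symm = cornerFace ρ S d) := by
  have key : ∀ b : G.Dart, ∃ a : G.Dart,
      (leftFace ρ a = cornerFace ρ S b ∧ leftFace ρ a.symm = cornerFace ρ S (ρ b)) ∨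
      (leftFace ρ a = cornerFace ρ S (ρ b) ∧ leftFace ρ a.symm = cornerFace ρ S b) := by
    intro b
    unfold cornerFace
    rw [hρ.isRotation.fst_apply]
    split_ifs with h
    · exact ⟨ρ b, Or.inl ⟨leftFace_rot ρ b, rfl⟩⟩
    · exact ⟨b, Or.inl ⟨rfl, (leftFace_rot ρ b).symm⟩⟩
  rcases hρ.eq_or_eq_rot d d' hfst with h | rfl | h
  · exact absurd h hne
  · exact key d
  · obtain ⟨a, ha⟩ := key d'
    rw [show ρ d' = d by rw [h, hρ.rot_rot_rot]] at ha
    exact ⟨a, ha.symm⟩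

variable [Fintype V]

/-- If the edges leaving `S` join faces in two independent sets `A` and `B`, then the facial walks
of the rotation flipped at `S` do not repeat vertices. -/
theorem IsTightRotation.eq_of_flip (hρ : IsTightRotation ρ) {S : Set V} {A B : Set (Face ρ)}
    (hcut : ∀ d : G.Dart, ¬ (d.fst ∈ S ↔ d.snd ∈ S) →
      (leftFace ρ d ∈ A ∧ leftFace ρ d.symm ∈ B) ∨ (leftFace ρ d ∈ B ∧ leftFace ρ d.symm ∈ A))
    (hA : ∀ d : G.Dart, ¬ (leftFace ρ d ∈ A ∧ leftFace ρ d.symm ∈ A))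
    (hB : ∀ d : G.Dart, ¬ (leftFace ρ d ∈ B ∧ leftFace ρ d.symm ∈ B)) {d d' : G.Dart}
    (hface : leftFace (hρ.isRotation.flip (flipSign S)) d =
      leftFace (hρ.isRotation.flip (flipSign S)) d') (hfst : d.fst = d'.fst) : d = d' := by
  set ψ := facePerm (hρ.isRotation.flip (flipSign S)) with hψ
  have hψfst : ∀ d, (ψ d).fst = d.snd := fun d => hρ.isRotation.fst_zpow _ _
  have hstep : ∀ d, cornerFace ρ S (ψ d) = if d.snd ∈ S then leftFace ρ d.symm else leftFace ρ d :=
    cornerFace_facePerm_flip hρ.isRotation S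
  -- Crossing the cut exchanges `A` with `B` and inside with outside at once, so this condition
  -- persists along a new facial walk.
  have inv : ∀ A B : Set (Face ρ),
      (∀ d : G.Dart, ¬ (d.fst ∈ S ↔ d.snd ∈ S) → (leftFace ρ d ∈ A ∧ leftFace ρ d.symm ∈ B) ∨
        (leftFace ρ d ∈ B ∧ leftFace ρ d.symm ∈ A)) →
      (∀ d : G.Dart, ¬ (leftFace ρ d ∈ A ∧ leftFace ρ d.symm ∈ A)) →
      (∀ d : G.Dart, ¬ (leftFace ρ d ∈ B ∧ leftFace ρ d.symm ∈ B)) →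
      ∀ d, (if d.fst ∈ S then cornerFace ρ S d ∈ A else cornerFace ρ S d ∈ B) →
        (if (ψ d).fst ∈ S then cornerFace ρ S (ψ d) ∈ A else cornerFace ρ S (ψ d) ∈ B) := by
    intro A B hcut hA hB d hd
    have hc := hcut d
    have hA' := hA d
    have hB' := hB d
    rw [hstep, hψfst]
    unfold cornerFace at hd
    by_cases h1 : d.fst ∈ S <;> by_cases h2 : d.snd ∈ S <;>
      simp only [h1, h2, if_true, if_false] at hd hc ⊢ <;> tauto
  have iter : ∀ (P : G.Dart → Prop), (∀ d, P d → P (ψ d)) → P d → P d' := by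
    intro P hP h
    obtain ⟨n, -, rfl⟩ := (leftFace_eq_iff.1 hface).exists_pow_eq'
    clear hface hfst
    induction n with
    | zero => exact h
    | succ n ih => rw [pow_succ', Perm.mul_apply]; exact hP _ ih
  by_contra hne
  obtain ⟨a, ha⟩ := hρ.exists_dart_of_cornerFace S hfst hne
  have typed : ∀ A B : Set (Face ρ),
      (∀ d : G.Dart, ¬ (d.fst ∈ S ↔ d.snd ∈ S) → (leftFace ρ d ∈ A ∧ leftFace ρ d.symm ∈ B) ∨
        (leftFace ρ d ∈ B ∧ leftFace ρ d.symm ∈ A)) →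
      (∀ d : G.Dart, ¬ (leftFace ρ d ∈ A ∧ leftFace ρ d.symm ∈ A)) →
      (∀ d : G.Dart, ¬ (leftFace ρ d ∈ B ∧ leftFace ρ d.symm ∈ B)) →
      ¬ (if d.fst ∈ S then cornerFace ρ S d ∈ A else cornerFace ρ S d ∈ B) := by
    intro A B hcut hA hB h
    have h' := iter _ (inv A B hcut hA hB) h
    rw [← hfst] at h'
    have hA' := hA a
    have hB' := hB a
    by_cases h1 : d.fst ∈ S
    · rw [if_pos h1] at h h'
      rcases ha with ha | ha <;> rw [ha.1, ha.2] at hA' <;> tauto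
    · rw [if_neg h1] at h h'
      rcases ha with ha | ha <;> rw [ha.1, ha.2] at hB' <;> tauto
  have t1 := typed A B hcut hA hB
  have t2 := typed B A (fun d hd => (hcut d hd).symm) hB hA
  -- The remaining walks have a corner face outside `A` and `B`; they never meet a cut edge, so
  -- their corner face is constant.
  have hout : cornerFace ρ S d ∉ A ∧ cornerFace ρ S d ∉ B := by
    by_cases h1 : d.fst ∈ S <;> simp only [h1, if_true, if_false] at t1 t2 <;> tauto
  have hconst : cornerFace ρ S d' = cornerFace ρ S d := by
    refine iter (fun b => cornerFace ρ S b = cornerFace ρ S d) (fun b hb => ?_) rfl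
    rw [← hb] at hout ⊢
    rw [hstep]
    have hc := hcut b
    unfold cornerFace at hout ⊢
    by_cases h1 : b.fst ∈ S <;> by_cases h2 : b.snd ∈ S <;>
      simp only [h1, h2, if_true, if_false] at hout hc ⊢ <;> tauto
  have := hρ.leftFace_ne a
  rcases ha with ha | ha <;> rw [ha.1, ha.2, hconst] at this <;> exact this rfl

variable [DecidableRel G.Adj]

/-- Flipping the rotation at one side of a nonempty edge cut destroys sphericity. -/
theorem IsTightRotation.card_face_flip_ne (hG : G.Connected) (hρ : IsTightRotation ρ) {S : Set V}
    {a : G.Dart} (ha : ¬ (a.fst ∈ S ↔ a.snd ∈ S)) :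
    Nat.card V + Nat.card (Face (hρ.isRotation.flip (flipSign S))) ≠ Nat.card G.edgeSet + 2 := by
  intro hχ
  set ρ' := hρ.isRotation.flip (flipSign S) with hρ'
  -- The cochain `x` marks the cut edges on the boundary of the old face to the left of `a`. On
  -- every dart it is the change of `δ` of the corner face, so it telescopes to zero around each new
  -- face.
  let δ : Face ρ → ZMod 2 := fun g => if g = leftFace ρ a then 1 else 0
  let x : G.edgeSet → ZMod 2 := fun e =>
    if ((dartEdge_surjective e).choose.fst ∈ S ↔ (dartEdge_surjective e).choose.snd ∈ S) then 0
    else δ (leftFace ρ (dartEdge_surjective e).choose) +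
      δ (leftFace ρ (dartEdge_surjective e).choose.symm)
  have hx : ∀ d, x (dartEdge d) = if (d.fst ∈ S ↔ d.snd ∈ S) then 0 else
      δ (leftFace ρ d) + δ (leftFace ρ d.symm) := by
    intro d
    have h := (dartEdge_surjective (dartEdge d)).choose_spec
    rw [dartEdge_eq_iff] at h
    dsimp only [x]
    rcases h with h | h <;> rw [h]
    rw [Dart.symm_symm, add_comm (δ (leftFace ρ d.symm))]
    exact if_congr (Iff.comm) rfl rfl
  have hzero : faceSum ρ' x = 0 := by
    ext f
    rw [faceSum_apply, Pi.zero_apply,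
      ← sum_add_facePerm_eq_zero ρ' f (fun d => δ (cornerFace ρ S d))]
    refine Finset.sum_congr rfl fun d _ => ?_
    rw [hx, cornerFace_facePerm_flip hρ.isRotation S, cornerFace]
    by_cases h1 : d.fst ∈ S <;> by_cases h2 : d.snd ∈ S <;> simp only [h1, h2, if_true, if_false]
    · exact (CharTwo.add_self_eq_zero _).symm
    · simp only [iff_false, not_true, if_false]; exact add_comm _ _
    · simp only [iff_true, if_false]
    · exact (CharTwo.add_self_eq_zero _).symm
  obtain ⟨s, hs⟩ := exists_coboundary_of_faceSum_eq_zero hG (hρ.isRotation.isRotation_flip _) a hχ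
    hzero
  -- The old face across `a` shares only that edge with the face on the left of `a`, so `x` sums to
  -- 1 around it, which is impossible for a coboundary.
  have h1 := congrFun (faceSum_coboundary hρ.isRotation s) (leftFace ρ a.symm)
  rw [hs, faceSum_apply, Finset.sum_eq_single a.symm] at h1
  · rw [hx, if_neg (by rwa [iff_comm] at ha)] at h1
    simp only [δ, Dart.symm_symm, (hρ.leftFace_ne a).symm, if_true, if_false, Pi.zero_apply] at h1
    exact absurd h1 (by decide)
  · intro b hb hne
    rw [Finset.mem_filter] at hb
    rw [hx]
    split_ifs with h
    · rfl
    · have h2 : leftFace ρ b.symm ≠ leftFace ρ a := fun h2 =>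
        hne (hρ.eq_of_leftFace_eq _ _ hb.2 (by rw [h2, Dart.symm_symm]))
      simp only [δ, h2, hb.2, (hρ.leftFace_ne a).symm, if_false, add_zero]
  · intro h
    simp at h

/-- If the edges of a nonempty edge cut join faces in two independent sets, then flipping the
rotation at one side of the cut yields a strong embedding of positive genus. -/
theorem IsTightRotation.exists_strong_of_cut (hG : G.Connected) (hcubic : G.IsRegularOfDegree 3)
    (hρ : IsTightRotation ρ) (hχ : Nat.card V + Nat.card (Face ρ) = Nat.card G.edgeSet + 2)
    {S : Set V} {A B : Set (Face ρ)}
    (hcut : ∀ d : G.Dart, d.fst ∈ S → d.snd ∉ S →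
      (leftFace ρ d ∈ A ∧ leftFace ρ d.symm ∈ B) ∨ (leftFace ρ d ∈ B ∧ leftFace ρ d.symm ∈ A))
    (hA : ∀ d : G.Dart, ¬ (leftFace ρ d ∈ A ∧ leftFace ρ d.symm ∈ A))
    (hB : ∀ d : G.Dart, ¬ (leftFace ρ d ∈ B ∧ leftFace ρ d.symm ∈ B))
    {a : G.Dart} (ha : a.fst ∈ S) (ha' : a.snd ∉ S) :
    ∃ (e : G.CellularEmbedding) (g : ℕ), e.IsStrong ∧ 0 < g ∧ e.IsOrientableOfGenus g := by
  have hρ' := hρ.isRotation.isRotation_flip (flipSign S)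
  have hcut' : ∀ d : G.Dart, ¬ (d.fst ∈ S ↔ d.snd ∈ S) →
      (leftFace ρ d ∈ A ∧ leftFace ρ d.symm ∈ B) ∨
        (leftFace ρ d ∈ B ∧ leftFace ρ d.symm ∈ A) := by
    intro d hd
    by_cases h1 : d.fst ∈ S
    · exact hcut d h1 (by tauto)
    · have := hcut d.symm (by change d.snd ∈ S; tauto) h1
      rw [Dart.symm_symm] at this
      tauto
  have h1 := card_add_card_face_le hG hρ' a
  have h2 := hρ.card_face_flip_ne hG (S := S) (a := a) (by tauto)
  have h3 := card_face_mod_two hcubic hρ.isRotation hρ'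
  -- The genus is half the loss of faces: the loss is even by `h3`, and positive by `h1` and `h2`.
  refine ⟨CellularEmbedding.ofRotation hρ',
    (Nat.card (Face ρ) - Nat.card (Face (hρ.isRotation.flip (flipSign S)))) / 2,
    CellularEmbedding.isStrong_ofRotation hρ' (fun d => (hρ'.cubic hcubic d).1)
      (fun d d' => hρ.eq_of_flip hcut' hA hB), by omega,
    CellularEmbedding.isOrientable_ofRotation hρ', ?_⟩
  rw [CellularEmbedding.eulerChar, CellularEmbedding.card_cell_ofRotation]
  omega

end Flip

end SimpleGraph

/-! ### Cuts around an even face and along an induced dual 4-cycle. -/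

namespace SimpleGraph

open Equiv

variable {V : Type*} {G : SimpleGraph V} {ρ : Perm G.Dart}

namespace IsTightRotation

theorem eq_of_leftFace_of_fst (hρ : IsTightRotation ρ) {d d' : G.Dart}
    (hface : leftFace ρ d = leftFace ρ d') (hfst : d'.fst = d.fst) : d = d' := by
  rcases hρ.eq_or_eq_rot d d' hfst with h | rfl | h
  · exact h.symm
  · rw [leftFace_rot] at hface
    exact absurd hface (hρ.leftFace_ne d)
  · obtain rfl : ρ d' = d := by rw [h, hρ.rot_rot_rot]
    rw [leftFace_rot] at hface
    exact absurd hface.symm (hρ.leftFace_ne d')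

/-- Two edges of a face whose other faces are adjacent are consecutive. -/
theorem consecutive (hρ : IsTightRotation ρ) {p q a : G.Dart} (hpq : leftFace ρ p = leftFace ρ q)
    (hp : leftFace ρ a = leftFace ρ p.symm) (hq : leftFace ρ a.symm = leftFace ρ q.symm) :
    facePerm ρ p = q ∨ facePerm ρ q = p := by
  obtain ⟨v, hv, -, hv'⟩ := hρ.exists_common_vertex p a q.symm hp.symm hq
    (by rw [Dart.symm_symm, hpq])
  change p.fst = v ∨ p.snd = v at hv
  change q.snd = v ∨ q.fst = v at hv'
  have hne : p ≠ q := by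
    rintro rfl
    exact hρ.leftFace_ne a (hp.trans hq.symm)
  -- A face meets each vertex at most once, so two distinct edges of it that share a vertex must
  -- meet end to start.
  rcases hv with hv | hv <;> rcases hv' with hv' | hv'
  · right
    exact hρ.eq_of_leftFace_of_fst (by rw [leftFace_facePerm, hpq])
      (by rw [hρ.isRotation.fst_facePerm, hv, hv'])
  · exact absurd (hρ.eq_of_leftFace_of_fst hpq (hv'.trans hv.symm)) hne
  · refine absurd ((facePerm ρ).injective (hρ.eq_of_leftFace_of_fst
      (by simpa only [leftFace_facePerm] using hpq) ?_)) hne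
    rw [hρ.isRotation.fst_facePerm, hρ.isRotation.fst_facePerm, hv, hv']
  · left
    exact hρ.eq_of_leftFace_of_fst (by rw [leftFace_facePerm, hpq])
      (by rw [hρ.isRotation.fst_facePerm, hv, hv'])

/-- At the end of `p` the face uses `p.symm` and `facePerm ρ p`; the third dart `ρ (facePerm ρ p)`
is the spoke pointing away from the face. It separates the faces across these two consecutive edges.
-/
theorem rot_rot_facePerm (hρ : IsTightRotation ρ) (p : G.Dart) :
    ρ (ρ (facePerm ρ p)) = p.symm := hρ.rot_rot_rot p.symm

theorem leftFace_symm_spoke (hρ : IsTightRotation ρ) (p : G.Dart) :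
    leftFace ρ (ρ (facePerm ρ p)).symm = leftFace ρ p.symm := by
  rw [← leftFace_rot, hρ.rot_rot_facePerm]

/-- A dart that leaves the vertices of a face is the third dart at its initial vertex. -/
theorem exists_eq_spoke (hρ : IsTightRotation ρ) {b d : G.Dart} (hfst : d.fst = b.fst)
    (hsnd : ∀ c : G.Dart, leftFace ρ c = leftFace ρ b → c.fst ≠ d.snd) :
    ∃ p, facePerm ρ p = b ∧ d = ρ b := by
  obtain ⟨p, rfl⟩ := (facePerm ρ).surjective b
  refine ⟨p, rfl, ?_⟩
  rcases hρ.eq_or_eq_rot _ d hfst with rfl | h | h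
  · exact absurd (hρ.isRotation.fst_facePerm _) (hsnd _ (leftFace_facePerm ρ _))
  · exact h
  · rw [hρ.rot_rot_facePerm] at h
    subst h
    exact absurd rfl (hsnd p (leftFace_facePerm ρ p).symm)

/-- If the far end of the spoke lay on the face, an edge there would share both its faces with
`facePerm ρ p`, hence be that edge, and would be parallel to the spoke. -/
theorem fst_ne_snd_spoke (hρ : IsTightRotation ρ) (p : G.Dart) {b : G.Dart}
    (hb : leftFace ρ b = leftFace ρ p) : b.fst ≠ (ρ (facePerm ρ p)).snd := by
  intro h
  set t := ρ (facePerm ρ p) with ht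
  have htf : leftFace ρ t = leftFace ρ (facePerm ρ p).symm := leftFace_rot ρ _
  rcases hρ.eq_or_eq_rot t.symm b h with rfl | rfl | rfl
  · rw [ht, hρ.leftFace_symm_spoke] at hb
    exact hρ.leftFace_ne p hb.symm
  · rw [leftFace_rot, Dart.symm_symm, htf, ← leftFace_facePerm ρ p] at hb
    exact hρ.leftFace_ne _ hb.symm
  · rw [leftFace_rot] at hb
    have h1 := hρ.eq_of_leftFace_eq (ρ t.symm).symm (facePerm ρ p)
      (by rw [hb, leftFace_facePerm]) (by rw [Dart.symm_symm, leftFace_rot, Dart.symm_symm, htf])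
    refine hρ.rot_ne t.symm (Dart.ext _ _ (Prod.ext (hρ.isRotation.fst_apply _) ?_))
    change (ρ t.symm).symm.fst = t.fst
    rw [h1, ht, hρ.isRotation.fst_apply]

variable [Fintype V] [DecidableRel G.Adj]

/-- A face of even length yields a strong embedding of positive genus. -/
theorem exists_strong_of_even_face (hG : G.Connected) (hcubic : G.IsRegularOfDegree 3)
    (hρ : IsTightRotation ρ) (hχ : Nat.card V + Nat.card (Face ρ) = Nat.card G.edgeSet + 2)
    {d₀ : G.Dart} (heven : ∀ n, (facePerm ρ ^ n) d₀ = d₀ → Even n) :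
    ∃ (e : G.CellularEmbedding) (g : ℕ), e.IsStrong ∧ 0 < g ∧ e.IsOrientableOfGenus g := by
  have hle : ∀ m n, m ≤ n → (facePerm ρ ^ m) d₀ = (facePerm ρ ^ n) d₀ → (Even m ↔ Even n) := by
    intro m n hmn h
    obtain ⟨k, rfl⟩ := Nat.exists_eq_add_of_le hmn
    rw [pow_add, Perm.mul_apply] at h
    have := heven k ((facePerm ρ ^ m).injective h).symm
    simp [Nat.even_add, this]
  have hpar : ∀ m n, (facePerm ρ ^ m) d₀ = (facePerm ρ ^ n) d₀ → (Even m ↔ Even n) := by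
    intro m n h
    rcases le_total m n with hmn | hmn
    · exact hle m n hmn h
    · exact (hle n m hmn h.symm).symm
  -- Adjacent neighbours of the face lie across consecutive edges, whose positions have opposite
  -- parity; even length makes this parity well defined.
  have hind : ∀ P : ℕ → Prop, (∀ m n, P m → P n → (Even m ↔ Even n)) → ∀ d : G.Dart,
      ¬ (leftFace ρ d ∈ {f | ∃ n, P n ∧ leftFace ρ ((facePerm ρ ^ n) d₀).symm = f} ∧
        leftFace ρ d.symm ∈ {f | ∃ n, P n ∧ leftFace ρ ((facePerm ρ ^ n) d₀).symm = f}) := by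
    rintro P hP d ⟨⟨m, hm, hdm⟩, ⟨n, hn, hdn⟩⟩
    have hmn := hP m n hm hn
    rcases hρ.consecutive (by simp) hdm.symm hdn.symm with h | h <;>
      rw [← Perm.mul_apply, ← pow_succ'] at h <;>
      · have := hpar _ _ h
        rw [Nat.even_add_one] at this
        tauto
  refine hρ.exists_strong_of_cut hG hcubic hχ
    (S := {v | ∃ b, leftFace ρ b = leftFace ρ d₀ ∧ b.fst = v})
    (A := {f | ∃ n, Even n ∧ leftFace ρ ((facePerm ρ ^ n) d₀).symm = f})
    (B := {f | ∃ n, ¬ Even n ∧ leftFace ρ ((facePerm ρ ^ n) d₀).symm = f})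
    (a := ρ (facePerm ρ d₀)) ?_ (hind _ fun m n hm hn => by tauto)
    (hind _ fun m n hm hn => by tauto) ?_ ?_
  · rintro d ⟨b, hb, hbd⟩ hd
    obtain ⟨p, rfl, rfl⟩ := hρ.exists_eq_spoke hbd.symm fun c hc hcd => hd ⟨c, hc.trans hb, hcd⟩
    rw [leftFace_facePerm, eq_comm, leftFace_eq_iff] at hb
    obtain ⟨n, -, rfl⟩ := hb.exists_pow_eq'
    have h1 : leftFace ρ ((facePerm ρ ^ (n + 1)) d₀).symm =
        leftFace ρ (ρ (facePerm ρ ((facePerm ρ ^ n) d₀))) := by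
      rw [leftFace_rot, pow_succ', Perm.mul_apply]
    have h2 := (hρ.leftFace_symm_spoke ((facePerm ρ ^ n) d₀)).symm
    by_cases hn : Even n
    · exact Or.inr ⟨⟨n + 1, by rwa [Nat.even_add_one, not_not], h1⟩, ⟨n, hn, h2⟩⟩
    · exact Or.inl ⟨⟨n + 1, by rwa [Nat.even_add_one], h1⟩, ⟨n, hn, h2⟩⟩
  · exact ⟨facePerm ρ d₀, leftFace_facePerm ρ d₀, (hρ.isRotation.fst_apply _).symm⟩
  · rintro ⟨b, hb, hbd⟩
    exact hρ.fst_ne_snd_spoke d₀ hb hbd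

/-- An induced 4-cycle of the dual graph yields a strong embedding of positive genus. -/
theorem exists_strong_of_dual_four_cycle (hG : G.Connected) (hcubic : G.IsRegularOfDegree 3)
    (hρ : IsTightRotation ρ) (hχ : Nat.card V + Nat.card (Face ρ) = Nat.card G.edgeSet + 2)
    {a b c d : G.Dart} (hab : leftFace ρ a.symm = leftFace ρ b)
    (hbc : leftFace ρ b.symm = leftFace ρ c) (hcd : leftFace ρ c.symm = leftFace ρ d)
    (hda : leftFace ρ d.symm = leftFace ρ a) (hac : leftFace ρ a ≠ leftFace ρ c)
    (hbd : leftFace ρ b ≠ leftFace ρ d)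
    (hac' : ∀ x, ¬ (leftFace ρ x = leftFace ρ a ∧ leftFace ρ x.symm = leftFace ρ c))
    (hbd' : ∀ x, ¬ (leftFace ρ x = leftFace ρ b ∧ leftFace ρ x.symm = leftFace ρ d)) :
    ∃ (e : G.CellularEmbedding) (g : ℕ), e.IsStrong ∧ 0 < g ∧ e.IsOrientableOfGenus g := by
  classical
  have hadj : ∀ x y : G.Dart, leftFace ρ x.symm = leftFace ρ y → leftFace ρ x ≠ leftFace ρ y.symm →
      dartEdge x ≠ dartEdge y := by
    intro x y h h' he
    rcases dartEdge_eq_iff.1 he with rfl | rfl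
    · exact hρ.leftFace_ne _ h.symm
    · exact h' rfl
  have hopp : ∀ x y : G.Dart, leftFace ρ x ≠ leftFace ρ y → leftFace ρ x ≠ leftFace ρ y.symm →
      dartEdge x ≠ dartEdge y := by
    intro x y h h' he
    rcases dartEdge_eq_iff.1 he with rfl | rfl
    · exact h rfl
    · exact h' rfl
  have h2 : (2 : Face ρ → ZMod 2) = 0 := by ext f; rfl
  obtain ⟨S, hS⟩ := exists_cut_of_dual_cycle hG hρ.isRotation hχ a (l := [a, b, c, d])
    (by
      have e1 := hadj a b hab (by rwa [hbc])
      have e2 := hadj b c hbc (by rwa [hcd])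
      have e3 := hadj c d hcd (by rw [hda]; exact hac.symm)
      have e4 := hadj d a hda (by rw [hab]; exact hbd.symm)
      have e5 := hopp a c hac (by rw [hcd, ← hda]; exact (hρ.leftFace_ne d).symm)
      have e6 := hopp b d hbd (by rw [hda, ← hab]; exact (hρ.leftFace_ne a).symm)
      simp [e1, e2, e3, e4.symm, e5, e6])
    (by
      simp only [List.map_cons, List.map_nil, List.sum_cons, List.sum_nil, hab, hbc, hcd, hda]
      linear_combination (Pi.single (leftFace ρ a) 1 + Pi.single (leftFace ρ b) 1 +
        Pi.single (leftFace ρ c) 1 + Pi.single (leftFace ρ d) 1) * h2)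
  have hindep : ∀ f g : Face ρ, (∀ x, ¬ (leftFace ρ x = f ∧ leftFace ρ x.symm = g)) → ∀ x,
      ¬ (leftFace ρ x ∈ ({f, g} : Set (Face ρ)) ∧ leftFace ρ x.symm ∈ ({f, g} : Set (Face ρ))) := by
    rintro f g h x ⟨h3 | h3, h4 | h4⟩
    · exact hρ.leftFace_ne x (h3.trans h4.symm)
    · exact h x ⟨h3, h4⟩
    · exact h x.symm ⟨h4, by rwa [Dart.symm_symm]⟩
    · exact hρ.leftFace_ne x (h3.trans h4.symm)
  have hcut : ∀ x : G.Dart, x.fst ∈ S → x.snd ∉ S →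
      (leftFace ρ x ∈ ({leftFace ρ a, leftFace ρ c} : Set (Face ρ)) ∧
        leftFace ρ x.symm ∈ ({leftFace ρ b, leftFace ρ d} : Set (Face ρ))) ∨
      (leftFace ρ x ∈ ({leftFace ρ b, leftFace ρ d} : Set (Face ρ)) ∧
        leftFace ρ x.symm ∈ ({leftFace ρ a, leftFace ρ c} : Set (Face ρ))) := by
    intro x h3 h4
    have hx := (hS x).2 (by tauto)
    simp only [List.map_cons, List.map_nil, List.mem_cons, List.not_mem_nil, or_false,
      dartEdge_eq_iff] at hx
    rcases hx with (rfl | rfl) | (rfl | rfl) | (rfl | rfl) | (rfl | rfl) <;>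
      simp [hab, hbc, hcd, hda]
  have ha := (hS a).1 (by simp)
  by_cases h3 : a.fst ∈ S
  · exact hρ.exists_strong_of_cut hG hcubic hχ hcut (hindep _ _ hac') (hindep _ _ hbd') h3 (by tauto)
  · exact hρ.exists_strong_of_cut hG hcubic hχ hcut (hindep _ _ hac') (hindep _ _ hbd') (a := a.symm)
      (by change a.snd ∈ S; tauto) h3

end IsTightRotation

end SimpleGraph

/-! ### The link of a dual edge, and triangular faces. -/

namespace SimpleGraph

open Equiv

variable {V : Type*} {G : SimpleGraph V} {ρ : Perm G.Dart}

/-- The length of the face on the left of a dart. -/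
noncomputable def faceLength (ρ : Perm G.Dart) (d : G.Dart) : ℕ :=
  Function.minimalPeriod (facePerm ρ) d

theorem facePerm_pow_eq_self_iff {d : G.Dart} {n : ℕ} :
    (facePerm ρ ^ n) d = d ↔ faceLength ρ d ∣ n := by
  rw [← Perm.iterate_eq_pow]
  exact Function.isPeriodicPt_iff_minimalPeriod_dvd

theorem facePerm_pow_faceLength (d : G.Dart) : (facePerm ρ ^ faceLength ρ d) d = d :=
  facePerm_pow_eq_self_iff.2 dvd_rfl

theorem facePerm_pow_inj {d : G.Dart} {m n : ℕ} (hm : m < faceLength ρ d)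
    (hn : n < faceLength ρ d) (h : (facePerm ρ ^ m) d = (facePerm ρ ^ n) d) : m = n := by
  rw [← Perm.iterate_eq_pow, ← Perm.iterate_eq_pow] at h
  exact (Function.iterate_eq_iterate_iff_of_lt_minimalPeriod hm hn).1 h

theorem faceLength_pos [Finite V] (d : G.Dart) : 0 < faceLength ρ d := by
  rcases Nat.eq_zero_or_pos (faceLength ρ d) with h | h
  · have := facePerm_pow_eq_self_iff.1
      (show (facePerm ρ ^ orderOf (facePerm ρ)) d = d by rw [pow_orderOf_eq_one]; rfl)
    rw [h, zero_dvd_iff] at this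
    exact absurd this (orderOf_pos (facePerm ρ)).ne'
  · exact h

theorem exists_facePerm_pow_eq [Finite V] {d b : G.Dart} (h : leftFace ρ b = leftFace ρ d) :
    ∃ n < faceLength ρ d, (facePerm ρ ^ n) d = b := by
  obtain ⟨n, -, rfl⟩ := (leftFace_eq_iff.1 h.symm).exists_pow_eq'
  refine ⟨n % faceLength ρ d, Nat.mod_lt _ (faceLength_pos d), ?_⟩
  rw [← Perm.iterate_eq_pow, ← Perm.iterate_eq_pow]
  exact Function.iterate_mod_minimalPeriod_eq

/-- The faces across the edges of the face on the left of `d`, apart from `d` itself, whose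
distance from `d` along that face is congruent to `r` modulo 2. -/
def sideFaces (ρ : Perm G.Dart) (d : G.Dart) (r : ℕ) : Set (Face ρ) :=
  {f | ∃ i, 0 < i ∧ i < faceLength ρ d ∧ i % 2 = r ∧ leftFace ρ ((facePerm ρ ^ i) d).symm = f}

/-- One of the two colour classes of the link of the dual edge crossing `d`. -/
def linkClass (ρ : Perm G.Dart) (d : G.Dart) : Set (Face ρ) :=
  sideFaces ρ d 0 ∪ sideFaces ρ d.symm 1

namespace IsTightRotation

theorem sideFaces_indep (hρ : IsTightRotation ρ) (d₀ : G.Dart) (r : ℕ) (d : G.Dart) :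
    ¬ (leftFace ρ d ∈ sideFaces ρ d₀ r ∧ leftFace ρ d.symm ∈ sideFaces ρ d₀ r) := by
  have key : ∀ i j, i < faceLength ρ d₀ → 0 < j → j < faceLength ρ d₀ → i % 2 = j % 2 →
      facePerm ρ ((facePerm ρ ^ i) d₀) ≠ (facePerm ρ ^ j) d₀ := by
    intro i j hi hj hj' hij h
    rw [← Perm.mul_apply, ← pow_succ'] at h
    rcases Nat.lt_or_ge (i + 1) (faceLength ρ d₀) with h1 | h1
    · have := facePerm_pow_inj h1 hj' h
      omega
    · rw [show i + 1 = faceLength ρ d₀ by omega, facePerm_pow_faceLength, eq_comm,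
        facePerm_pow_eq_self_iff] at h
      exact absurd (Nat.le_of_dvd hj h) (by omega)
  rintro ⟨⟨i, hi, hi', hir, hdi⟩, ⟨j, hj, hj', hjr, hdj⟩⟩
  rcases hρ.consecutive (by simp only [leftFace_facePerm_pow]) hdi.symm hdj.symm with h | h
  · exact key i j hi' hj hj' (hir.trans hjr.symm) h
  · exact key j i hj' hi hi' (hjr.trans hir.symm) h

/-- The last edge of a face before `d` and the first edge after `d.symm` in the other face are
incident to the same third face. -/
theorem leftFace_last [Finite V] (hρ : IsTightRotation ρ) (d : G.Dart) :
    leftFace ρ ((facePerm ρ ^ (faceLength ρ d - 1)) d).symm =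
      leftFace ρ ((facePerm ρ ^ 1) d.symm).symm := by
  have hpos := faceLength_pos (ρ := ρ) d
  set p := (facePerm ρ ^ (faceLength ρ d - 1)) d with hp
  have h1 : facePerm ρ p = d := by
    rw [hp, ← Perm.mul_apply, ← pow_succ', Nat.sub_add_cancel hpos, facePerm_pow_faceLength]
  rw [← hρ.leftFace_symm_spoke p, h1, pow_one, facePerm_apply, Dart.symm_symm]

variable [Fintype V]

/-- Such an adjacency closes a dual 4-cycle with the two faces of `d₀`, so it has a diagonal. The
diagonal forces one of the two link faces to be the one where the two sides of the link meet, and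
then both lie in the same side class, which is independent. -/
theorem not_link_adj (hρ : IsTightRotation ρ) (hodd : ∀ d : G.Dart, faceLength ρ d % 2 = 1)
    (hlen : ∀ d : G.Dart, 3 < faceLength ρ d)
    (hno : ∀ a b c d : G.Dart, leftFace ρ a.symm = leftFace ρ b → leftFace ρ b.symm = leftFace ρ c →
      leftFace ρ c.symm = leftFace ρ d → leftFace ρ d.symm = leftFace ρ a →
      leftFace ρ a ≠ leftFace ρ c → leftFace ρ b ≠ leftFace ρ d →
      (∃ x, leftFace ρ x = leftFace ρ a ∧ leftFace ρ x.symm = leftFace ρ c) ∨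
      (∃ x, leftFace ρ x = leftFace ρ b ∧ leftFace ρ x.symm = leftFace ρ d))
    (d₀ d : G.Dart) :
    ¬ (leftFace ρ d ∈ sideFaces ρ d₀ 0 ∧ leftFace ρ d.symm ∈ sideFaces ρ d₀.symm 1) := by
  rintro ⟨⟨i, hi, hi', hir, hdi⟩, ⟨j, hj, hj', hjr, hdj⟩⟩
  have hk := hodd d₀
  have hm := hodd d₀.symm
  have hk3 := hlen d₀
  have hm3 := hlen d₀.symm
  have hself : ∀ (b : G.Dart) (n : ℕ), 0 < n → n < faceLength ρ b →
      leftFace ρ ((facePerm ρ ^ n) b).symm ≠ leftFace ρ b.symm := by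
    intro b n hn hn' h
    have := facePerm_pow_eq_self_iff.1
      (hρ.eq_of_leftFace_eq _ b (leftFace_facePerm_pow ρ n b) h)
    exact absurd (Nat.le_of_dvd hn this) (by omega)
  rcases hno ((facePerm ρ ^ i) d₀) d ((facePerm ρ ^ j) d₀.symm).symm d₀.symm hdi hdj.symm
    (by rw [Dart.symm_symm, leftFace_facePerm_pow])
    (by rw [Dart.symm_symm, leftFace_facePerm_pow])
    (by
      have := hself d₀.symm j hj hj'
      rw [Dart.symm_symm] at this
      rw [leftFace_facePerm_pow]
      exact this.symm)
    (by rw [← hdi]; exact hself d₀ i hi hi') with ⟨x, hx, hx'⟩ | ⟨x, hx, hx'⟩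
  · rw [leftFace_facePerm_pow] at hx
    -- The face at position `j` is adjacent to both faces of `d₀`, so `j` is 1 or the last position;
    -- the last position is even.
    have hj1 : j = 1 := by
      rcases hρ.consecutive (p := d₀.symm) (q := (facePerm ρ ^ j) d₀.symm) (a := x)
        (leftFace_facePerm_pow ρ _ _).symm (by rw [Dart.symm_symm, hx]) hx' with h | h
      · rw [← pow_one (facePerm ρ)] at h
        exact (facePerm_pow_inj (by omega) hj' (by simpa using h)).symm
      · rw [← Perm.mul_apply, ← pow_succ', facePerm_pow_eq_self_iff] at h
        have := Nat.le_of_dvd (by omega) h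
        omega
    subst hj1
    refine hρ.sideFaces_indep d₀ 0 d ⟨⟨i, hi, hi', hir, hdi⟩,
      ⟨faceLength ρ d₀ - 1, by omega, by omega, by omega, ?_⟩⟩
    rw [hρ.leftFace_last, hdj]
  · have hi1 : i = faceLength ρ d₀ - 1 := by
      rcases hρ.consecutive (p := (facePerm ρ ^ i) d₀) (q := d₀) (a := x)
        (leftFace_facePerm_pow ρ _ _) (by rw [hx, hdi]) hx' with h | h
      · rw [← Perm.mul_apply, ← pow_succ', facePerm_pow_eq_self_iff] at h
        have := Nat.le_of_dvd (by omega) h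
        omega
      · have := facePerm_pow_inj (ρ := ρ) (d := d₀) (m := 1) (n := i) (by omega) hi' (by simpa using h)
        omega
    subst hi1
    refine hρ.sideFaces_indep d₀.symm 1 d ⟨⟨1, by omega, by omega, rfl, ?_⟩,
      ⟨j, hj, hj', hjr, hdj⟩⟩
    rw [← hρ.leftFace_last, hdi]

theorem link_cut (hρ : IsTightRotation ρ) {d₀ b d : G.Dart} (hb : leftFace ρ b = leftFace ρ d₀)
    (hfst : d.fst = b.fst)
    (hsnd : ∀ c, leftFace ρ c = leftFace ρ d₀ ∨ leftFace ρ c = leftFace ρ d₀.symm → c.fst ≠ d.snd) :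
    (leftFace ρ d ∈ linkClass ρ d₀ ∧ leftFace ρ d.symm ∈ linkClass ρ d₀.symm) ∨
      (leftFace ρ d ∈ linkClass ρ d₀.symm ∧ leftFace ρ d.symm ∈ linkClass ρ d₀) := by
  obtain ⟨p, rfl, rfl⟩ := hρ.exists_eq_spoke hfst fun c hc => hsnd c (Or.inl (hc.trans hb))
  rw [leftFace_facePerm] at hb
  obtain ⟨n, hn, rfl⟩ := exists_facePerm_pow_eq hb
  have h1 : leftFace ρ ((facePerm ρ ^ (n + 1)) d₀).symm =
      leftFace ρ (ρ (facePerm ρ ((facePerm ρ ^ n) d₀))) := by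
    rw [leftFace_rot, pow_succ', Perm.mul_apply]
  have h2 := (hρ.leftFace_symm_spoke ((facePerm ρ ^ n) d₀)).symm
  rcases Nat.eq_zero_or_pos n with rfl | hn0
  · exact absurd rfl (hsnd (ρ (facePerm ρ ((facePerm ρ ^ 0) d₀))).symm (Or.inr h2.symm))
  rcases Nat.lt_or_ge (n + 1) (faceLength ρ d₀) with hn1 | hn1
  · unfold linkClass
    rw [Dart.symm_symm]
    rcases Nat.mod_two_eq_zero_or_one n with hr | hr
    · exact Or.inr ⟨Or.inr ⟨n + 1, by omega, hn1, by omega, h1⟩, Or.inl ⟨n, hn0, hn, hr, h2⟩⟩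
    · exact Or.inl ⟨Or.inl ⟨n + 1, by omega, hn1, by omega, h1⟩, Or.inr ⟨n, hn0, hn, hr, h2⟩⟩
  · rw [show n + 1 = faceLength ρ d₀ by omega, facePerm_pow_faceLength] at h1
    exact absurd (hρ.isRotation.fst_facePerm _)
      (hsnd (facePerm ρ (ρ (facePerm ρ ((facePerm ρ ^ n) d₀))))
        (Or.inr (by rw [leftFace_facePerm, ← h1])))

variable [DecidableRel G.Adj]

/-- If all faces have odd length at least 5 and the dual graph has no induced 4-cycle, then the
link of a dual edge yields a strong embedding of positive genus. -/
theorem exists_strong_of_link (hG : G.Connected) (hcubic : G.IsRegularOfDegree 3)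
    (hρ : IsTightRotation ρ) (hχ : Nat.card V + Nat.card (Face ρ) = Nat.card G.edgeSet + 2)
    (hodd : ∀ d : G.Dart, faceLength ρ d % 2 = 1) (hlen : ∀ d : G.Dart, 3 < faceLength ρ d)
    (hno : ∀ a b c d : G.Dart, leftFace ρ a.symm = leftFace ρ b → leftFace ρ b.symm = leftFace ρ c →
      leftFace ρ c.symm = leftFace ρ d → leftFace ρ d.symm = leftFace ρ a →
      leftFace ρ a ≠ leftFace ρ c → leftFace ρ b ≠ leftFace ρ d →
      (∃ x, leftFace ρ x = leftFace ρ a ∧ leftFace ρ x.symm = leftFace ρ c) ∨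
      (∃ x, leftFace ρ x = leftFace ρ b ∧ leftFace ρ x.symm = leftFace ρ d))
    (d₀ : G.Dart) :
    ∃ (e : G.CellularEmbedding) (g : ℕ), e.IsStrong ∧ 0 < g ∧ e.IsOrientableOfGenus g := by
  have hindep : ∀ d₀ d : G.Dart,
      ¬ (leftFace ρ d ∈ linkClass ρ d₀ ∧ leftFace ρ d.symm ∈ linkClass ρ d₀) := by
    rintro d₀ d ⟨h1 | h1, h2 | h2⟩
    · exact hρ.sideFaces_indep d₀ 0 d ⟨h1, h2⟩
    · exact hρ.not_link_adj hodd hlen hno d₀ d ⟨h1, h2⟩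
    · exact hρ.not_link_adj hodd hlen hno d₀ d.symm ⟨h2, by rwa [Dart.symm_symm]⟩
    · exact hρ.sideFaces_indep d₀.symm 1 d ⟨h1, h2⟩
  have hpow : ∀ n, 0 < n → n ≤ 3 → (facePerm ρ ^ n) d₀ ≠ d₀ := by
    intro n hn hn3 h
    have := Nat.le_of_dvd hn (facePerm_pow_eq_self_iff.1 h)
    have := hlen d₀
    omega
  -- The spoke witnessing that the cut is nonempty starts one edge beyond `d₀`, since the spoke at
  -- the end of `d₀` stays on the second face. Length greater than 3 keeps its far end off both
  -- faces.
  refine hρ.exists_strong_of_cut hG hcubic hχ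
    (S := {v | ∃ b, (leftFace ρ b = leftFace ρ d₀ ∨ leftFace ρ b = leftFace ρ d₀.symm) ∧ b.fst = v})
    (A := linkClass ρ d₀) (B := linkClass ρ d₀.symm) (a := ρ (facePerm ρ (facePerm ρ d₀)))
    ?_ (hindep d₀) (hindep d₀.symm) ?_ ?_
  · rintro d ⟨b, hb | hb, hbd⟩ hd
    · exact hρ.link_cut hb hbd.symm fun c hc hcd => hd ⟨c, hc, hcd⟩
    · have := hρ.link_cut hb hbd.symm fun c hc hcd => hd ⟨c, by
        rw [Dart.symm_symm] at hc; exact hc.symm, hcd⟩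
      rw [Dart.symm_symm] at this
      exact this.symm
  · exact ⟨facePerm ρ (facePerm ρ d₀), Or.inl (by rw [leftFace_facePerm, leftFace_facePerm]),
      (hρ.isRotation.fst_apply _).symm⟩
  · rintro ⟨b, hb | hb, hbd⟩
    · exact hρ.fst_ne_snd_spoke (facePerm ρ d₀) (by rw [hb, leftFace_facePerm]) hbd
    · set t := ρ (facePerm ρ (facePerm ρ d₀)) with ht
      have htf : leftFace ρ t = leftFace ρ (facePerm ρ (facePerm ρ d₀)).symm := leftFace_rot ρ _
      rcases hρ.eq_or_eq_rot t.symm b hbd with rfl | rfl | rfl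
      · rw [ht, hρ.leftFace_symm_spoke] at hb
        exact hpow 1 (by omega) (by omega)
          (hρ.eq_of_leftFace_eq _ _ (leftFace_facePerm ρ d₀) hb)
      · rw [leftFace_rot, Dart.symm_symm, htf] at hb
        exact hpow 2 (by omega) (by omega)
          (hρ.eq_of_leftFace_eq _ _ (by rw [leftFace_facePerm_pow]) hb)
      · rw [leftFace_rot] at hb
        rcases hρ.consecutive (p := facePerm ρ (facePerm ρ d₀)) (q := d₀) (a := ρ t.symm)
          (by rw [leftFace_facePerm, leftFace_facePerm])
          (by rw [leftFace_rot, Dart.symm_symm, htf]) hb with h | h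
        · exact hpow 3 (by omega) (by omega) h
        · exact hpow 1 (by omega) (by omega) ((facePerm ρ).injective h.symm)

/-- The only cyclically 4-edge-connected cubic plane graph with a triangular face is `K₄`. -/
theorem nonempty_iso_of_triangle (hcubic : G.IsRegularOfDegree 3)
    (hcyc : G.IsCyclicallyEdgeConnected 4) (hρ : IsTightRotation ρ) {d₀ : G.Dart}
    (h3 : (facePerm ρ ^ 3) d₀ = d₀) : Nonempty (G ≃g (⊤ : SimpleGraph (Fin 4))) := by
  classical
  let S : Finset V := {d₀.fst, (facePerm ρ d₀).fst, (facePerm ρ (facePerm ρ d₀)).fst}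
  have hface : ∀ b, leftFace ρ b = leftFace ρ d₀ →
      b = d₀ ∨ b = facePerm ρ d₀ ∨ b = facePerm ρ (facePerm ρ d₀) := by
    intro b hb
    obtain ⟨n, hn, rfl⟩ := exists_facePerm_pow_eq hb
    have := Nat.le_of_dvd (by omega) (facePerm_pow_eq_self_iff.1 h3)
    have hn3 : n < 3 := by omega
    interval_cases n
    · exact Or.inl rfl
    · exact Or.inr (Or.inl rfl)
    · exact Or.inr (Or.inr rfl)
  have hS : ∀ v, v ∈ S ↔ ∃ b, leftFace ρ b = leftFace ρ d₀ ∧ b.fst = v := by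
    intro v
    simp only [S, Finset.mem_insert, Finset.mem_singleton]
    constructor
    · rintro (rfl | rfl | rfl)
      · exact ⟨_, rfl, rfl⟩
      · exact ⟨_, leftFace_facePerm ρ _, rfl⟩
      · exact ⟨_, (leftFace_facePerm ρ _).trans (leftFace_facePerm ρ _), rfl⟩
    · rintro ⟨b, hb, rfl⟩
      rcases hface b hb with rfl | rfl | rfl <;> simp
  let E : Finset (Sym2 V) :=
    {(ρ d₀).edge, (ρ (facePerm ρ d₀)).edge, (ρ (facePerm ρ (facePerm ρ d₀))).edge}
  have hE : ∀ d : G.Dart, d.fst ∈ S → d.snd ∉ S → d.edge ∈ E := by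
    intro d h1 h2
    obtain ⟨b, hb, hbd⟩ := (hS _).1 h1
    obtain ⟨p, hp, rfl⟩ := hρ.exists_eq_spoke hbd.symm
      fun c hc hcd => h2 ((hS _).2 ⟨c, hc.trans hb, hcd⟩)
    rcases hface b hb with rfl | rfl | rfl <;> simp [E]
  -- The filter retains only spokes that cross the cut, so that the edge set is literally the cut of
  -- `S`.
  have hcard : (E.filter fun e => ∃ d : G.Dart, d.edge = e ∧ ¬ (d.fst ∈ S ↔ d.snd ∈ S)).card ≤ 3 :=
    (Finset.card_filter_le _ _).trans Finset.card_le_three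
  have hsub := subsingleton_or_compl_subsingleton_of_cut hcubic hcyc (S := (S : Set V))
    (A := E.filter fun e => ∃ d : G.Dart, d.edge = e ∧ ¬ (d.fst ∈ S ↔ d.snd ∈ S))
    (by
      intro e he
      obtain ⟨-, d, rfl, -⟩ := Finset.mem_filter.1 he
      exact d.edge_mem) hcard
    (by
      intro d
      rw [Finset.mem_filter]
      simp only [Finset.mem_coe]
      constructor
      · rintro ⟨-, d', he, hd'⟩
        rcases (dart_edge_eq_iff _ _).1 he with rfl | rfl
        · exact hd'
        · rw [iff_comm]; exact hd'
      · intro h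
        refine ⟨?_, d, rfl, h⟩
        by_cases h1 : d.fst ∈ S
        · exact hE d h1 (by tauto)
        · rw [← Dart.edge_symm]
          exact hE d.symm (by change d.snd ∈ S; tauto) h1)
  have hcompl : Sᶜ.card ≤ 1 := by
    rcases hsub with h | h
    · refine absurd (h ((hS _).2 ⟨d₀, rfl, rfl⟩)
        ((hS _).2 ⟨facePerm ρ d₀, leftFace_facePerm ρ d₀, rfl⟩)) ?_
      rw [hρ.isRotation.fst_facePerm]
      exact d₀.fst_ne_snd
    · rw [Finset.card_le_one]
      intro x hx y hy
      exact h (by simpa using hx) (by simpa using hy)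
  have hV : Fintype.card V = 4 := by
    have h1 := Finset.card_add_card_compl S
    have h2 : S.card ≤ 3 := Finset.card_le_three
    have h4 := G.degree_lt_card_verts d₀.fst
    rw [hcubic.degree_eq] at h4
    omega
  have htop : G = ⊤ := by
    ext u w
    rw [top_adj]
    refine ⟨fun h => h.ne, fun h => ?_⟩
    have h1 : G.neighborFinset u = Finset.univ.erase u := by
      apply Finset.eq_of_subset_of_card_le
      · intro x hx
        rw [mem_neighborFinset] at hx
        exact Finset.mem_erase.2 ⟨hx.ne', Finset.mem_univ _⟩
      · rw [Finset.card_erase_of_mem (Finset.mem_univ _), Finset.card_univ, hV,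
          card_neighborFinset_eq_degree, hcubic.degree_eq]
    rw [← mem_neighborFinset, h1]
    exact Finset.mem_erase.2 ⟨h.symm, Finset.mem_univ _⟩
  subst htop
  exact ⟨Iso.completeGraph (Fintype.equivFinOfCardEq hV)⟩

end IsTightRotation

end SimpleGraph

/-! ### Choosing the cut. -/

open SimpleGraph

theorem mainTheorem4 {V : Type*} [Fintype V] (G : SimpleGraph V) [DecidableRel G.Adj]
    (hconn : G.Connected) (hcubic : G.IsRegularOfDegree 3) (hplanar : G.IsPlanar)
    (hcyc : G.IsCyclicallyEdgeConnected 4)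
    (hK4 : IsEmpty (G ≃g (⊤ : SimpleGraph (Fin 4)))) :
    ∃ (e : G.CellularEmbedding) (g : ℕ), e.IsStrong ∧ 0 < g ∧ e.IsOrientableOfGenus g := by
  obtain ⟨e, ⟨o, ho⟩, hχ⟩ := hplanar
  have hrot : IsRotation e.rot := e.rot_isCycleOn
  have hρ' := hrot.isRotation_flip o
  rw [CellularEmbedding.eulerChar, CellularEmbedding.card_cell_eq e o ho hrot] at hχ
  -- Orienting all vertices coherently by `o` replaces the signed spherical embedding by an
  -- untwisted rotation.
  set ρ := hrot.flip o
  replace hχ : Nat.card V + Nat.card (Face ρ) = Nat.card G.edgeSet + 2 := by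
    push_cast at hχ
    omega
  have hρ := isTightRotation hconn hcubic hcyc hρ' hχ
  by_contra hgoal
  have hodd : ∀ d : G.Dart, faceLength ρ d % 2 = 1 := by
    intro d
    by_contra h
    refine hgoal (hρ.exists_strong_of_even_face hconn hcubic hχ (d₀ := d) fun n hn => ?_)
    rw [facePerm_pow_eq_self_iff] at hn
    exact (Nat.even_iff.2 (by omega)).trans_dvd hn
  have hlen : ∀ d : G.Dart, 3 < faceLength ρ d := by
    intro d
    have h1 := hodd d
    have h3 : faceLength ρ d ≠ 1 := fun h => hρ'.facePerm_ne d (by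
      have := facePerm_pow_faceLength (ρ := ρ) d
      rwa [h, pow_one] at this)
    have h4 : faceLength ρ d ≠ 3 := fun h => by
      obtain ⟨i⟩ := hρ.nonempty_iso_of_triangle hcubic hcyc (d₀ := d)
        (by rw [← h, facePerm_pow_faceLength])
      exact hK4.false i
    omega
  obtain ⟨v⟩ := hconn.nonempty
  obtain ⟨w, hw⟩ := (G.degree_pos_iff_exists_adj v).1 (by rw [hcubic.degree_eq]; omega)
  refine hgoal (hρ.exists_strong_of_link hconn hcubic hχ hodd hlen ?_ ⟨(v, w), hw⟩)
  intro a b c d hab hbc hcd hda hac hbd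
  by_contra h
  rw [not_or, not_exists, not_exists] at h
  exact hgoal (hρ.exists_strong_of_dual_four_cycle hconn hcubic hχ hab hbc hcd hda hac hbd h.1 h.2)
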